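/- Let $\ell\ge 1$ be an integer, let $F_\ell$ be the free group on $a_1,\dots,a_\ell$, and let $T_{2\ell}$ be the regular tree of valency $2\ell$ with edges of length $1$, seen as the Cayley graph of $F_\ell$. Let $X$ be the metric graph obtained from $T_{2\ell}$ by gluing, for every pair of adjacent vertices, a second edge of length $1$ with the same endpoints, equipped with its length metric $d$. Let $\Gamma<\mathrm{Isom}(X)$ be the group $F_\ell$ acting by left translations on $T_{2\ell}$ and correspondingly on the added edges. Then: (1) $X$ is proper, geodesic, Gromov-hyperbolic and has bounded geometry (for all $0<r\le R$, every closed ball of radius $R$ can be covered by a number of balls of radius $r$ bounded independently of its centre), but it is not line-convex: there are isometric embeddings $\gamma,\gamma'\colon\mathbb R\to X$ for which $t\mapsto d(\gamma(t),\gamma'(t))$ is not convex. (2) The action of $F_\ell$ is faithful, so $\Gamma\cong F_\ell$, and $\Gamma$ is discrete, cocompact, torsion-free and acts freely on $X$; if $\ell\ge 2$, it is non-elementary (its limit set in the Gromov boundary $\partial X$ has more than two points). (3) Let $\mathrm{Geod}(X)$ be the space of geodesic lines (isometric embeddings $\mathbb R\to X$) with the topology of uniform convergence on compact sets, and let $\bar\Phi_1$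 be the map induced on $\Gamma\backslash\mathrm{Geod}(X)$ by $\gamma\mapsto\gamma(\cdot+1)$. For every $x\in X$, $$h_{\mathrm{top}}(\Gamma\backslash\mathrm{Geod}(X),\bar\Phi_1)=\log(4\ell-2)>\log(2\ell-1)=h_{\mathrm{crit}}(X;\Gamma)=\limsup_{T\to+\infty}\frac1T\log\#(\Gamma x\cap B(x,T)).$$ Here, for a continuous self-map $T$ of a metrizable space $Y$, $$h_{\mathrm{top}}(Y,T)=\inf_{\rho}\ \sup_{K}\ \lim_{r\to0}\ \limsup_{n\to+\infty}\frac1n\log\mathrm{Cov}_{\rho^n}(K,r),$$ where $\rho$ runs over the metrics inducing the topology of $Y$, $K$ over the compact subsets of $Y$, $\rho^n(y,y')=\max_{0\le i<n}\rho(T^iy,T^iy')$, and $\mathrm{Cov}_{\rho^n}(K,r)$ is the minimal number of $\rho^n$-balls of radius $r$ needed to cover $K$. In particular, for $\ell\ge2$, there are a proper, geodesic, Gromov-hyperbolic metric space $X$ with bounded geometry that is not line-convex and a discrete, non-elementary, cocompact, torsion-free group $\Gamma<\mathrm{Isom}(X)$ with $h_{\mathrm{top}}(\Gamma\backslash\mathrm{Geod}(X),\bar\Phi_1)>h_{\mathrm{crit}}(X;\Gamma)$.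 -/

import Mathlib

open Filter Topology Set
open scoped ENNReal

noncomputable section

namespace GeodesicEntropy

/-! ### Coverings and metric notions -/

/-- `cov d B r` is the minimal cardinality of an `r`-dense subset of `B` for the distance
function `d`, i.e. of a set `S ⊆ B` whose closed `d`-balls of radius `r` cover `B`. -/
def cov {Y : Type*} (d : Y → Y → ℝ) (B : Set Y) (r : ℝ) : ℕ∞ :=
  ⨅ S ∈ {S : Set Y | S ⊆ B ∧ ∀ y ∈ B, ∃ z ∈ S, d y z ≤ r}, S.encard

/-- Any two points are joined by a geodesic segment. -/
def IsGeodesicSpace (X : Type*) [MetricSpace X] : Prop :=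
  ∀ x y : X, ∃ γ : ℝ → X, γ 0 = x ∧ γ (dist x y) = y ∧
    ∀ s ∈ Icc (0 : ℝ) (dist x y), ∀ t ∈ Icc (0 : ℝ) (dist x y), dist (γ s) (γ t) = |s - t|

/-- The Gromov product `(y, z)_x`. -/
def gromovProd {X : Type*} [MetricSpace X] (x y z : X) : ℝ :=
  (dist x y + dist x z - dist y z) / 2

/-- Gromov hyperbolicity, through the four point condition. -/
def IsGromovHyperbolic (X : Type*) [MetricSpace X] : Prop :=
  ∃ δ : ℝ, 0 ≤ δ ∧ ∀ x y z w : X,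
    min (gromovProd w x y) (gromovProd w y z) - δ ≤ gromovProd w x z

/-- Bounded geometry: for all `0 < r ≤ R`, the balls of radius `R` can be covered by a number of
balls of radius `r` which is bounded independently of the centre. -/
def HasBoundedGeometry (X : Type*) [MetricSpace X] : Prop :=
  ∀ r R : ℝ, 0 < r → r ≤ R →
    (⨆ x : X, cov (fun y z : X => dist y z) (Metric.closedBall x R) r) < ⊤

/-- Line-convexity: the distance between two geodesic lines (isometric embeddings of `ℝ`) is a
convex function of the common parameter. -/
def IsLineConvex (X : Type*) [MetricSpace X] : Prop :=
  ∀ γ γ' : ℝ → X, Isometry γ → Isometry γ' →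
    ConvexOn ℝ univ (fun t => dist (γ t) (γ' t))

/-! ### Groups of isometries -/

section Groups

variable {X : Type*} [MetricSpace X]

/-- The orbit of `x` under a group `Γ` of isometries. -/
def orbitOf (Γ : Subgroup (X ≃ᵢ X)) (x : X) : Set X := {y | ∃ g ∈ Γ, y = g x}

/-- A group of isometries is discrete if only finitely many of its elements move a given point
by a bounded amount. -/
def IsDiscreteGroup (Γ : Subgroup (X ≃ᵢ X)) : Prop :=
  ∀ (x : X) (R : ℝ), {g : X ≃ᵢ X | g ∈ Γ ∧ g x ∈ Metric.closedBall x R}.Finite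

/-- The action is free. -/
def IsFreeGroupAction (Γ : Subgroup (X ≃ᵢ X)) : Prop :=
  ∀ g ∈ Γ, ∀ x : X, g x = x → g = 1

/-- The group has no nontrivial element of finite order. -/
def IsTorsionFreeGroup (Γ : Subgroup (X ≃ᵢ X)) : Prop :=
  ∀ g ∈ Γ, IsOfFinOrder g → g = 1

/-- Two points are equivalent if they lie in the same `Γ`-orbit. -/
def orbitSetoid (Γ : Subgroup (X ≃ᵢ X)) : Setoid X where
  r x y := ∃ g ∈ Γ, y = g x
  iseqv :=
    { refl := fun _ => ⟨1, Γ.one_mem, rfl⟩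
      symm := by
        rintro x y ⟨g, hg, rfl⟩
        exact ⟨g⁻¹, Γ.inv_mem hg, (g.symm_apply_apply x).symm⟩
      trans := by
        rintro x y z ⟨g, hg, rfl⟩ ⟨h, hh, rfl⟩
        exact ⟨h * g, Γ.mul_mem hh hg, rfl⟩ }

/-- `Γ` is cocompact if the quotient space `Γ \ X` (quotient topology) is compact. -/
def IsCocompactGroup (Γ : Subgroup (X ≃ᵢ X)) : Prop :=
  CompactSpace (Quotient (orbitSetoid Γ))

/-- The critical exponent
`limsup_{T → +∞} (1 / T) log #(Γ x ∩ B(x, T))`, computed at the base point `x`. -/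
def critExponent (Γ : Subgroup (X ≃ᵢ X)) (x : X) : EReal :=
  limsup (fun T : ℝ =>
    ENNReal.log (((orbitOf Γ x ∩ Metric.ball x T).encard : ℕ∞) : ℝ≥0∞) / (T : EReal)) atTop

variable (X) in
/-- Sequences `(z_n)` with `(z_n, z_m)_x → +∞` as `n, m → +∞`. (The condition does not depend on
the base point `x`, as changing it alters the Gromov products by a bounded amount.) -/
def GromovSeq : Type _ :=
  {z : ℕ → X // ∀ x : X, Tendsto (fun p : ℕ × ℕ => gromovProd x (z p.1) (z p.2)) atTop atTop}

variable (X) in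
/-- The Gromov boundary: sequences as above up to `(z_n) ∼ (z'_n)` iff
`(z_n, z'_m)_x → +∞` as `n, m → +∞`, which is an equivalence relation if the space is Gromov
hyperbolic. -/
def GromovBoundary : Type _ :=
  Quot (fun z z' : GromovSeq X =>
    ∀ x : X, Tendsto (fun p : ℕ × ℕ => gromovProd x (z.1 p.1) (z'.1 p.2)) atTop atTop)

/-- The limit set: the set of points of the Gromov boundary that are limits of sequences of points
of the orbit `Γ x`; a sequence of points of `X` converges to a point of the Gromov boundary when
it represents it. -/
def limitSet (Γ : Subgroup (X ≃ᵢ X)) (x : X) : Set (GromovBoundary X) :=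
  {ζ | ∃ z : GromovSeq X, (∀ n, z.1 n ∈ orbitOf Γ x) ∧ ζ = Quot.mk _ z}

/-- `Γ` is non-elementary if its limit set has more than two points. -/
def IsNonElementary (Γ : Subgroup (X ≃ᵢ X)) : Prop :=
  ∀ x : X, 2 < (limitSet Γ x).encard

end Groups

/-! ### Topological entropy -/

/-- The dynamical distance `d^n(y, y') = max_{0 ≤ i < n} d(T^i y, T^i y')`. -/
def dynDist {Y : Type*} (d : Y → Y → ℝ) (T : Y → Y) (n : ℕ) (y y' : Y) : ℝ :=
  ⨆ i : Fin n, d (T^[i] y) (T^[i] y')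

/-- The entropy of `T` on the set `K` for the distance `d`:
`lim_{r → 0} limsup_{n → +∞} (1 / n) log Cov_{d^n}(K, r)`. As the quantity increases when `r`
decreases, the limit as `r → 0` is written as a supremum over `r > 0`. -/
def entropyOn {Y : Type*} (d : Y → Y → ℝ) (T : Y → Y) (K : Set Y) : EReal :=
  ⨆ (r : ℝ) (_ : 0 < r),
    limsup (fun n : ℕ => ENNReal.log ((cov (dynDist d T n) K r : ℕ∞) : ℝ≥0∞) / (n : EReal)) atTop

/-- Bowen's topological entropy of a dynamical system on a metrizable space: the infimum, over all
metrics inducing the topology, of the supremum, over all compact sets, of the entropy. -/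
def topEntropy {Y : Type*} [t : TopologicalSpace Y] (T : Y → Y) : EReal :=
  ⨅ (m : MetricSpace Y) (_ : m.toPseudoMetricSpace.toUniformSpace.toTopologicalSpace = t),
    ⨆ (K : Set Y) (_ : IsCompact K), entropyOn (fun y z => m.dist y z) T K

/-! ### The geodesic flow -/

section Flow

variable (X : Type*) [MetricSpace X]

/-- The space of geodesic lines of `X`, with the topology of uniform convergence on compact
subsets of `ℝ` (the compact-open topology). -/
abbrev Geod : Type _ := {γ : C(ℝ, X) // Isometry γ}

variable {X}

/-- The geodesic flow `(Φ_t γ)(s) = γ (s + t)`. -/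
def Geod.flow (t : ℝ) (γ : Geod X) : Geod X :=
  ⟨γ.1.comp ⟨fun s => s + t, by fun_prop⟩,
    γ.2.comp (Isometry.of_dist_eq fun a b => dist_add_right a b t)⟩

/-- Two geodesic lines are equivalent if `γ' = g ∘ γ` for an element `g` of `Γ`. -/
def geodSetoid (Γ : Subgroup (X ≃ᵢ X)) : Setoid (Geod X) where
  r γ γ' := ∃ g ∈ Γ, ∀ s : ℝ, γ'.1 s = g (γ.1 s)
  iseqv :=
    { refl := fun _ => ⟨1, Γ.one_mem, fun _ => rfl⟩
      symm := by
        rintro γ γ' ⟨g, hg, h⟩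
        refine ⟨g⁻¹, Γ.inv_mem hg, fun s => ?_⟩
        rw [h s]
        exact (g.symm_apply_apply (γ.1 s)).symm
      trans := by
        rintro γ γ' γ'' ⟨g, hg, h⟩ ⟨k, hk, h'⟩
        refine ⟨k * g, Γ.mul_mem hk hg, fun s => ?_⟩
        rw [h' s, h s]
        rfl }

/-- The quotient `Γ \ Geod(X)`, with the quotient topology. -/
abbrev GeodQuot (Γ : Subgroup (X ≃ᵢ X)) : Type _ := Quotient (geodSetoid Γ)

/-- The quotient geodesic flow on `Γ \ Geod(X)` at time `t`. -/
def quotFlow (Γ : Subgroup (X ≃ᵢ X)) (t : ℝ) : GeodQuot Γ → GeodQuot Γ :=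
  Quotient.map (Geod.flow t) (by
    rintro γ γ' ⟨g, hg, h⟩
    exact ⟨g, hg, fun s => h (s + t)⟩)

end Flow

/-! ### The tree with doubled edges

The regular tree of valency `2ℓ` is the Cayley graph of the free group on `a_1, …, a_ℓ`: its
vertices are the elements `g` of the group, its edges are unit segments joining `g` to `g a_i`, and
the distance between two vertices `u`, `v` is the reduced length of `u⁻¹ v`. Doubling every edge
we get the metric graph with two unit edges between `g` and `g a_i`. -/

/-- A point of the disjoint union of all (doubled) edges: the edges between `base` and
`base * a_gen` are numbered by the boolean `copy`, and `pos` is the distance from `base` along the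
edge. -/
structure EdgePoint (ℓ : ℕ) where
  base : FreeGroup (Fin ℓ)
  gen : Fin ℓ
  copy : Bool
  pos : Icc (0 : ℝ) 1

namespace EdgePoint

variable {ℓ : ℕ}

/-- The two endpoints `base` and `base * a_gen` of the edge containing `p`. -/
def endpt (p : EdgePoint ℓ) (c : Bool) : FreeGroup (Fin ℓ) :=
  if c then p.base * FreeGroup.of p.gen else p.base

/-- The length of the part of the edge between `p` and the corresponding endpoint. -/
def arm (p : EdgePoint ℓ) (c : Bool) : ℝ := if c then 1 - (p.pos : ℝ) else p.pos

/-- The distance of two vertices of the tree. -/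
def vdist (u v : FreeGroup (Fin ℓ)) : ℝ := ((u⁻¹ * v).norm : ℝ)

/-- The length of a shortest path from `p` to `q` among those leaving the edge of `p` through one
of its endpoints and entering the edge of `q` through one of its endpoints. -/
def outerDist (p q : EdgePoint ℓ) : ℝ :=
  ⨅ c : Bool × Bool, (p.arm c.1 + vdist (p.endpt c.1) (q.endpt c.2) + q.arm c.2)

/-- `p` and `q` lie on the same edge. -/
def SameEdge (p q : EdgePoint ℓ) : Prop :=
  p.base = q.base ∧ p.gen = q.gen ∧ p.copy = q.copy

open Classical in
/-- The length of a shortest path from `p` to `q` in the graph. For points of the same edge,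
the segment of this edge between them is a shortest path. Two points have distance `0` exactly
when they are the same point of an edge or when they are endpoints of edges to be glued at the same
vertex. -/
instance : Dist (EdgePoint ℓ) where
  dist p q := if SameEdge p q then |(p.pos : ℝ) - q.pos| else outerDist p q

theorem vdist_triangle (u v w : FreeGroup (Fin ℓ)) : vdist u w ≤ vdist u v + vdist v w := by
  unfold vdist
  have h := FreeGroup.norm_mul_le (u⁻¹ * v) (v⁻¹ * w)
  have e : u⁻¹ * v * (v⁻¹ * w) = u⁻¹ * w := by group
  rw [e] at h
  exact_mod_cast h

theorem vdist_comm (u v : FreeGroup (Fin ℓ)) : vdist u v = vdist v u := by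
  unfold vdist
  rw [← FreeGroup.norm_inv_eq]
  simp

theorem vdist_self (u : FreeGroup (Fin ℓ)) : vdist u u = 0 := by simp [vdist]

theorem vdist_edge (u : FreeGroup (Fin ℓ)) (i : Fin ℓ) : vdist u (u * FreeGroup.of i) = 1 := by
  simp [vdist]

theorem outerDist_le (p q : EdgePoint ℓ) (c c' : Bool) :
    outerDist p q ≤ p.arm c + vdist (p.endpt c) (q.endpt c') + q.arm c' :=
  ciInf_le (Set.finite_range (fun c : Bool × Bool =>
    p.arm c.1 + vdist (p.endpt c.1) (q.endpt c.2) + q.arm c.2)).bddBelow (c, c')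

theorem exists_outerDist (p q : EdgePoint ℓ) : ∃ c c' : Bool,
    outerDist p q = p.arm c + vdist (p.endpt c) (q.endpt c') + q.arm c' := by
  obtain ⟨c, hc⟩ := exists_eq_ciInf_of_finite (f := fun c : Bool × Bool =>
    p.arm c.1 + vdist (p.endpt c.1) (q.endpt c.2) + q.arm c.2)
  exact ⟨c.1, c.2, hc.symm⟩

theorem outerDist_comm (p q : EdgePoint ℓ) : outerDist p q = outerDist q p := by
  apply le_antisymm
  · obtain ⟨c, c', h⟩ := exists_outerDist q p
    have := outerDist_le p q c' c
    rw [vdist_comm] at this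
    linarith
  · obtain ⟨c, c', h⟩ := exists_outerDist p q
    have := outerDist_le q p c' c
    rw [vdist_comm] at this
    linarith

theorem SameEdge.symm {p q : EdgePoint ℓ} (h : SameEdge p q) : SameEdge q p :=
  ⟨h.1.symm, h.2.1.symm, h.2.2.symm⟩

theorem SameEdge.trans {p q r : EdgePoint ℓ} (h : SameEdge p q) (h' : SameEdge q r) :
    SameEdge p r :=
  ⟨h.1.trans h'.1, h.2.1.trans h'.2.1, h.2.2.trans h'.2.2⟩

theorem SameEdge.endpt_eq {p q : EdgePoint ℓ} (h : SameEdge p q) (c : Bool) :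
    p.endpt c = q.endpt c := by
  simp [endpt, h.1, h.2.1]

theorem dist_of_same {p q : EdgePoint ℓ} (h : SameEdge p q) :
    dist p q = |(p.pos : ℝ) - q.pos| := if_pos h

theorem dist_of_not_same {p q : EdgePoint ℓ} (h : ¬ SameEdge p q) :
    dist p q = outerDist p q := if_neg h

theorem arm_le (p q : EdgePoint ℓ) (c : Bool) : p.arm c ≤ |(p.pos : ℝ) - q.pos| + q.arm c := by
  have h1 := le_abs_self ((p.pos : ℝ) - q.pos)
  have h2 := neg_abs_le ((p.pos : ℝ) - q.pos)
  cases c <;> simp only [arm, if_true, Bool.false_eq_true, if_false] <;> linarith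

theorem vdist_endpt_le (p : EdgePoint ℓ) (c c' : Bool) :
    vdist (p.endpt c) (p.endpt c') ≤ p.arm c + p.arm c' := by
  have h0 := p.pos.2.1
  have h1 := p.pos.2.2
  have e := vdist_edge p.base p.gen
  have e' := vdist_comm p.base (p.base * FreeGroup.of p.gen)
  have s := vdist_self p.base
  have s' := vdist_self (p.base * FreeGroup.of p.gen)
  cases c <;> cases c' <;>
    simp only [endpt, arm, if_true, Bool.false_eq_true, if_false] <;> linarith

theorem abs_le_outerDist {p q : EdgePoint ℓ} (h : SameEdge p q) :
    |(p.pos : ℝ) - q.pos| ≤ outerDist p q := by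
  obtain ⟨c, c', hc⟩ := exists_outerDist p q
  rw [hc, ← h.endpt_eq c', abs_le]
  have hp0 := p.pos.2.1
  have hp1 := p.pos.2.2
  have hq0 := q.pos.2.1
  have hq1 := q.pos.2.2
  have e := vdist_edge p.base p.gen
  have e' := vdist_comm p.base (p.base * FreeGroup.of p.gen)
  have s := vdist_self p.base
  have s' := vdist_self (p.base * FreeGroup.of p.gen)
  cases c <;> cases c' <;>
    simp only [endpt, arm, if_true, Bool.false_eq_true, if_false] <;> constructor <;> linarith

theorem dist_le_outerDist (p q : EdgePoint ℓ) : dist p q ≤ outerDist p q := by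
  by_cases h : SameEdge p q
  · rw [dist_of_same h]; exact abs_le_outerDist h
  · rw [dist_of_not_same h]

theorem outerDist_le_of_same {p q : EdgePoint ℓ} (h : SameEdge p q) (r : EdgePoint ℓ) :
    outerDist p r ≤ |(p.pos : ℝ) - q.pos| + outerDist q r := by
  obtain ⟨c, c', hc⟩ := exists_outerDist q r
  have h1 := outerDist_le p r c c'
  have h2 := arm_le p q c
  rw [h.endpt_eq c] at h1
  linarith

theorem dist_comm_aux (p q : EdgePoint ℓ) : dist p q = dist q p := by
  by_cases h : SameEdge p q
  · rw [dist_of_same h, dist_of_same h.symm, abs_sub_comm]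
  · rw [dist_of_not_same h, dist_of_not_same (fun h' => h h'.symm), outerDist_comm]

theorem dist_triangle_aux (p q r : EdgePoint ℓ) : dist p r ≤ dist p q + dist q r := by
  by_cases h1 : SameEdge p q <;> by_cases h2 : SameEdge q r
  · rw [dist_of_same h1, dist_of_same h2, dist_of_same (h1.trans h2)]
    exact abs_sub_le _ _ _
  · have h3 : ¬ SameEdge p r := fun h => h2 (h1.symm.trans h)
    rw [dist_of_same h1, dist_of_not_same h2, dist_of_not_same h3]
    exact outerDist_le_of_same h1 r
  · have h3 : ¬ SameEdge p r := fun h => h1 (h.trans h2.symm)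
    rw [dist_of_not_same h1, dist_of_same h2, dist_of_not_same h3, outerDist_comm p r,
      outerDist_comm p q, abs_sub_comm]
    linarith [outerDist_le_of_same h2.symm p]
  · rw [dist_of_not_same h1, dist_of_not_same h2]
    refine (dist_le_outerDist p r).trans ?_
    obtain ⟨c, c', hc⟩ := exists_outerDist p q
    obtain ⟨k, k', hk⟩ := exists_outerDist q r
    have a := outerDist_le p r c k'
    have b := vdist_triangle (p.endpt c) (q.endpt c') (r.endpt k')
    have b' := vdist_triangle (q.endpt c') (q.endpt k) (r.endpt k')
    have e := vdist_endpt_le q c' k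
    linarith

instance : PseudoMetricSpace (EdgePoint ℓ) where
  dist_self p := by rw [dist_of_same ⟨rfl, rfl, rfl⟩]; simp
  dist_comm := dist_comm_aux
  dist_triangle := dist_triangle_aux

/-- The free group acts on the edges by left translation, preserving generators, numbers of edges
and positions. -/
instance : MulAction (FreeGroup (Fin ℓ)) (EdgePoint ℓ) where
  smul g p := ⟨g * p.base, p.gen, p.copy, p.pos⟩
  one_smul p := by
    change (⟨1 * p.base, p.gen, p.copy, p.pos⟩ : EdgePoint ℓ) = p
    rw [one_mul]
  mul_smul g h p := by
    change (⟨g * h * p.base, p.gen, p.copy, p.pos⟩ : EdgePoint ℓ)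
      = ⟨g * (h * p.base), p.gen, p.copy, p.pos⟩
    rw [mul_assoc]

theorem sameEdge_smul (g : FreeGroup (Fin ℓ)) (p q : EdgePoint ℓ) :
    SameEdge (g • p) (g • q) ↔ SameEdge p q := by
  change (g * p.base = g * q.base ∧ _) ↔ _
  rw [mul_right_inj]
  rfl

theorem endpt_smul (g : FreeGroup (Fin ℓ)) (p : EdgePoint ℓ) (c : Bool) :
    (g • p).endpt c = g * p.endpt c := by
  cases c
  · rfl
  · exact mul_assoc g p.base (FreeGroup.of p.gen)

theorem outerDist_smul (g : FreeGroup (Fin ℓ)) (p q : EdgePoint ℓ) :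
    outerDist (g • p) (g • q) = outerDist p q := by
  unfold outerDist
  refine iInf_congr fun c => ?_
  have h : vdist ((g • p).endpt c.1) ((g • q).endpt c.2) = vdist (p.endpt c.1) (q.endpt c.2) := by
    rw [endpt_smul, endpt_smul]
    unfold vdist
    congr 2
    group
  rw [h]
  rfl

theorem dist_smul_aux (g : FreeGroup (Fin ℓ)) (p q : EdgePoint ℓ) :
    dist (g • p) (g • q) = dist p q := by
  by_cases h : SameEdge p q
  · rw [dist_of_same h, dist_of_same ((sameEdge_smul g p q).2 h)]
    rfl
  · rw [dist_of_not_same h, dist_of_not_same (fun h' => h ((sameEdge_smul g p q).1 h')),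
      outerDist_smul]

instance : IsIsometricSMul (FreeGroup (Fin ℓ)) (EdgePoint ℓ) where
  isometry_smul g := Isometry.of_dist_eq (dist_smul_aux g)

end EdgePoint

/-- The metric space obtained from the regular tree of valency `2ℓ` by gluing a second edge of
length `1` parallel to each edge: the quotient of the disjoint union of the edges in which the
points at distance `0` are identified, i.e. the ends of edges at the same vertex are glued. -/
abbrev DoubledTree (ℓ : ℕ) : Type := SeparationQuotient (EdgePoint ℓ)

instance (ℓ : ℕ) : IsIsometricSMul (FreeGroup (Fin ℓ)) (DoubledTree ℓ) where
  isometry_smul g := Isometry.of_dist_eq fun x y => by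
    obtain ⟨p, rfl⟩ := SeparationQuotient.surjective_mk x
    obtain ⟨q, rfl⟩ := SeparationQuotient.surjective_mk y
    change dist (SeparationQuotient.mk (g • p)) (SeparationQuotient.mk (g • q)) = _
    rw [SeparationQuotient.dist_mk, SeparationQuotient.dist_mk, dist_smul]

/-- The action of the free group on the doubled tree by left translations, as a homomorphism to
the isometry group. -/
def action (ℓ : ℕ) : FreeGroup (Fin ℓ) →* (DoubledTree ℓ ≃ᵢ DoubledTree ℓ) where
  toFun g := IsometryEquiv.constSMul g
  map_one' := IsometryEquiv.ext fun x => one_smul (FreeGroup (Fin ℓ)) x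
  map_mul' g h := IsometryEquiv.ext fun x => mul_smul g h x

/-- The free group of rank `ℓ` as a group of isometries of the doubled tree. -/
def freeIsomGroup (ℓ : ℕ) : Subgroup (DoubledTree ℓ ≃ᵢ DoubledTree ℓ) := (action ℓ).range

end GeodesicEntropy

end

open GeodesicEntropy

/-!
The doubled tree is within distance `1` of its vertices, that is, of the free group with its word
metric, where the Gromov product of two elements is the length of the longest common prefix of their
reduced words (`norm_inv_mul_add`). Common prefixes satisfy the ultrametric inequality, whence
hyperbolicity; discreteness, properness and bounded geometry follow from the finiteness of balls in
the free group. The critical exponent counts reduced words, in which every letter has `2ℓ - 1`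
possible successors (`card_chains`, `critExponent_eq`).

A geodesic line meets the set of vertices in a translate of `ℤ` and between two consecutive vertices
it follows one of the two copies of an edge (`exists_eq_vert`, `exists_letter`). Its combinatorial
data are thus a bi-infinite reduced word together with an arbitrary choice of a copy at each step,
and a time `τ ∈ [0, 1]`; conversely every such datum gives a geodesic line (`isometry_path`). Each
letter (a signed generator and a copy) has `2 (2ℓ - 1) = 4ℓ - 2` possible successors, so modulo the
free group the geodesic flow at time `1` is a continuous image of the product of `[0, 1]` with a
subshift in which every letter has `4ℓ - 2` successors, acted upon by the shift. Two lines which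
differ in one copy only are at distance `0`, `1`, `0` at the ends and at the middle of the edge, which
contradicts line-convexity.

The quotient of the space of lines is metrizable: it is compact, being the image of the coding, and
it is Hausdorff and second countable because the group is discrete and the quotient map is open
(`t2Space_geodQuot`, `secondCountableTopology_geodQuot`). For every metric on it, uniform continuity
of the coding bounds the covering numbers by the number of words of length `n + O(1)`
(`cov_dynDist_le`). In the other direction, at time `0` the first letter is determined by the point
of the quotient and lines with different first letters are at distance bounded below by compactness,
so that words of length `n` are separated by the dynamical distance (`le_cov_dynDist`). Hence the
entropy is `log (4ℓ - 2)` for every metric (`topEntropy_eq`).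
-/

noncomputable section

namespace GeodesicEntropy

/-! ### Chains in which every letter has the same number of successors -/

section Chains

variable {A : Type*} {R : A → A → Prop}

theorem finite_chains [Finite A] (a : A) (k : ℕ) :
    Finite {L : List A // L.length = k ∧ (a :: L).IsChain R} :=
  ((List.finite_length_eq A k).subset fun _ h => h.1).to_subtype

/-- If every letter has exactly `m` admissible successors, then `m ^ k` chains of length `k` can
follow a given letter. -/
theorem card_chains [Finite A] {m : ℕ} (hR : ∀ a, Nat.card {b // R a b} = m) (a : A) (k : ℕ) :
    Nat.card {L : List A // L.length = k ∧ (a :: L).IsChain R} = m ^ k := by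
  induction k generalizing a with
  | zero =>
    rw [pow_zero, Nat.card_eq_one_iff_unique]
    refine ⟨⟨fun x y => Subtype.ext ?_⟩, ⟨⟨[], by simp⟩⟩⟩
    rw [List.length_eq_zero_iff.1 x.2.1, List.length_eq_zero_iff.1 y.2.1]
  | succ k ih =>
    let e : {L : List A // L.length = k + 1 ∧ (a :: L).IsChain R} ≃
        Σ b : {b // R a b}, {L : List A // L.length = k ∧ (b.1 :: L).IsChain R} :=
      { toFun := fun L => match L with
          | ⟨b :: L, h⟩ => ⟨⟨b, (List.isChain_cons_cons.1 h.2).1⟩,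
              ⟨L, by simpa using h.1, (List.isChain_cons_cons.1 h.2).2⟩⟩
        invFun := fun x => ⟨x.1.1 :: x.2.1, by simp [x.2.2.1],
          List.isChain_cons_cons.2 ⟨x.1.2, x.2.2.2⟩⟩
        left_inv := by
          rintro ⟨_ | ⟨b, L⟩, h⟩
          · simp at h
          · rfl
        right_inv := fun _ => rfl }
    have : Fintype {b // R a b} := Fintype.ofFinite _
    have := fun b : {b // R a b} => finite_chains (R := R) b.1 k
    rw [Nat.card_congr e, Nat.card_sigma, Finset.sum_congr rfl fun b _ => ih b.1, Finset.sum_const,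
      Finset.card_univ, ← Nat.card_eq_fintype_card, hR, smul_eq_mul, pow_succ, mul_comm]

/-- A finite chain extends to an infinite one, by repeating its last letter. -/
theorem exists_chain_extension (hrefl : ∀ a, R a a) (L : List A) (a : A)
    (h : (a :: L).IsChain R) :
    ∃ s : ℕ → A, (∀ k, R (s k) (s (k + 1))) ∧ s 0 = a ∧ ∀ k, ∀ hk : k < L.length, s (k + 1) = L[k] := by
  induction L generalizing a with
  | nil => exact ⟨fun _ => a, fun _ => hrefl a, rfl, fun k hk => by simp at hk⟩
  | cons b L ih =>
    obtain ⟨hab, hL⟩ := List.isChain_cons_cons.1 h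
    obtain ⟨s, hs, h0, hk⟩ := ih b hL
    refine ⟨fun k => k.casesOn a s, ?_, rfl, ?_⟩
    · rintro (_ | k)
      · simpa [h0] using hab
      · exact hs k
    · rintro (_ | k) hk'
      · simpa using h0
      · simpa using hk k (by simpa using hk')

theorem isChain_map_range {s : ℕ → A} (hs : ∀ k, R (s k) (s (k + 1))) (n : ℕ) :
    ((List.range n).map s).IsChain R := by
  rw [List.isChain_map]
  rcases n with _ | n
  · simp
  · rw [List.isChain_range]
    intro k _
    exact hs k

theorem isChain_cons_map_range {s : ℕ → A} (hs : ∀ k, R (s k) (s (k + 1))) (n : ℕ) :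
    (s 0 :: (List.range n).map fun k => s (k + 1)).IsChain R := by
  have h : s 0 :: (List.range n).map (fun k => s (k + 1)) = (List.range (n + 1)).map s := by
    rw [List.range_succ_eq_map]
    simp [Function.comp_def]
  rw [h]
  exact isChain_map_range hs _

end Chains

/-! ### Words in the free group -/

section Words

open FreeGroup

variable {ℓ : ℕ}

theorem card_successors (a : Fin ℓ × Bool) :
    Nat.card {b : Fin ℓ × Bool // a.1 = b.1 → a.2 = b.2} = 2 * ℓ - 1 := by
  have h : ∀ b : Fin ℓ × Bool, (a.1 = b.1 → a.2 = b.2) ↔ b ≠ (a.1, !a.2) := by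
    rintro ⟨i, s⟩
    obtain ⟨j, t⟩ := a
    by_cases hij : j = i
    · subst hij
      cases s <;> cases t <;> simp
    · simp [hij, Ne.symm hij]
  rw [Nat.card_congr (Equiv.subtypeEquivRight h), Nat.card_eq_fintype_card,
    Fintype.card_subtype_compl]
  simp [mul_comm]

theorem norm_mk_of_isReduced {L : List (Fin ℓ × Bool)} (h : IsReduced L) :
    (mk L).norm = L.length := by
  rw [FreeGroup.norm, toWord_mk, h.reduce_eq]

theorem isReduced_invRev {L : List (Fin ℓ × Bool)} (h : IsReduced L) : IsReduced (invRev L) := by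
  rw [isReduced_iff_reduce_eq, reduce_invRev, h.reduce_eq]

/-- The length of the longest common prefix of two words. -/
def commonPrefix : List (Fin ℓ × Bool) → List (Fin ℓ × Bool) → ℕ
  | a :: L, b :: L' => if a = b then commonPrefix L L' + 1 else 0
  | _, _ => 0

theorem commonPrefix_ultrametric (L L' L'' : List (Fin ℓ × Bool)) :
    min (commonPrefix L L') (commonPrefix L' L'') ≤ commonPrefix L L'' := by
  induction L generalizing L' L'' with
  | nil => simp [commonPrefix]
  | cons a L ih =>
    rcases L' with _ | ⟨b, L'⟩
    · simp [commonPrefix]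
    rcases L'' with _ | ⟨c, L''⟩
    · simp [commonPrefix]
    have := ih L' L''
    simp only [commonPrefix]
    by_cases hab : a = b
    · by_cases hbc : b = c
      · simp [hab, hbc]; omega
      · simp [hbc]
    · simp [hab]

/-- The path from `mk L` to `mk L'` in the tree runs through the branch point, at the end of the
longest common prefix. -/
theorem norm_inv_mul_add (L L' : List (Fin ℓ × Bool)) (h : IsReduced L) (h' : IsReduced L') :
    ((mk L)⁻¹ * mk L').norm + 2 * commonPrefix L L' = L.length + L'.length := by
  induction L generalizing L' with
  | nil =>
    have : mk ([] : List (Fin ℓ × Bool)) = 1 := rfl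
    simp [commonPrefix, this, norm_mk_of_isReduced h']
  | cons a L ih =>
    rcases L' with _ | ⟨b, L'⟩
    · have : mk ([] : List (Fin ℓ × Bool)) = 1 := rfl
      rw [this, mul_one, norm_inv_eq, norm_mk_of_isReduced h]
      simp [commonPrefix]
    by_cases hab : a = b
    · subst hab
      have e : (mk (a :: L))⁻¹ * mk (a :: L') = (mk L)⁻¹ * mk L' := by
        have e1 : ∀ L : List (Fin ℓ × Bool), mk (a :: L) = mk [a] * mk L := fun L => by
          rw [mul_mk]; rfl
        rw [e1 L, e1 L']
        group
      have := ih L' h.tail h'.tail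
      rw [e]
      simp only [commonPrefix, if_true, List.length_cons]
      omega
    · have hr : IsReduced (invRev (a :: L) ++ b :: L') := by
        refine List.isChain_append.2 ⟨isReduced_invRev h, h', ?_⟩
        intro x hx y hy
        have hx' : x = (a.1, !a.2) := by simpa [invRev, eq_comm] using hx
        have hy' : y = b := by simpa [eq_comm] using hy
        subst hx' hy'
        obtain ⟨i, s⟩ := a
        obtain ⟨j, t⟩ := y
        intro (hij : i = j)
        subst hij
        cases s <;> cases t <;> simp_all
      rw [inv_mk, mul_mk, norm_mk_of_isReduced hr]
      simp [commonPrefix, hab, invRev_length]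

theorem finite_norm_le (n : ℕ) : {g : FreeGroup (Fin ℓ) | g.norm ≤ n}.Finite :=
  Set.Finite.preimage toWord_injective.injOn (List.finite_length_le (Fin ℓ × Bool) n)

/-- Lower bound for the growth of balls in the free group. -/
theorem pow_le_card_ball (hℓ : 1 ≤ ℓ) (n : ℕ) :
    (2 * ℓ - 1) ^ n ≤ Nat.card {g : FreeGroup (Fin ℓ) // g.norm ≤ n} := by
  have a : Fin ℓ × Bool := (⟨0, hℓ⟩, true)
  rw [← card_chains (fun a => card_successors a) a n]
  have : Finite {g : FreeGroup (Fin ℓ) // g.norm ≤ n} := (finite_norm_le n).to_subtype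
  refine Nat.card_le_card_of_injective
    (fun L => ⟨mk L.1, (norm_mk_of_isReduced (IsReduced.infix (L₂ := a :: L.1) L.2.2
      (List.suffix_cons a L.1).isInfix)).trans_le L.2.1.le⟩) ?_
  intro L L' h
  have h' : mk L.1 = mk L'.1 := congrArg Subtype.val h
  have r : ∀ L : {L : List (Fin ℓ × Bool) // L.length = n ∧
      (a :: L).IsChain fun a b => a.1 = b.1 → a.2 = b.2}, reduce L.1 = L.1 := fun L =>
    (IsReduced.infix (L₂ := a :: L.1) L.2.2 (List.suffix_cons a L.1).isInfix).reduce_eq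
  exact Subtype.ext (by rw [← r L, ← r L', reduce.sound h'])

/-- Upper bound for the growth of balls in the free group. -/
theorem card_ball_le (hℓ : 1 ≤ ℓ) (n : ℕ) :
    Nat.card {g : FreeGroup (Fin ℓ) // g.norm ≤ n} ≤ (n + 1) * (2 * ℓ) * (2 * ℓ - 1) ^ n := by
  let C : ℕ → (Fin ℓ × Bool) → Type := fun k a => {L : List (Fin ℓ × Bool) // L.length = k ∧
      (a :: L).IsChain fun a b => a.1 = b.1 → a.2 = b.2}
  have : ∀ k a, Finite (C k a) := fun k a => finite_chains a k
  have a₀ : Fin ℓ × Bool := (⟨0, hℓ⟩, true)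
  have hf : ∀ g : FreeGroup (Fin ℓ), ((g.toWord.headD a₀) :: g.toWord).IsChain
      (fun a b => a.1 = b.1 → a.2 = b.2) := by
    intro g
    have h := isReduced_toWord (x := g)
    cases hg : g.toWord with
    | nil => simp
    | cons b L =>
      rw [hg] at h
      exact List.isChain_cons_cons.2 ⟨fun _ => rfl, h⟩
  let f : {g : FreeGroup (Fin ℓ) // g.norm ≤ n} →
      Σ p : Fin (n + 1) × (Fin ℓ × Bool), C p.1 p.2 := fun g =>
    ⟨(⟨g.1.norm, Nat.lt_succ_of_le g.2⟩, g.1.toWord.headD a₀), ⟨g.1.toWord, rfl, hf g.1⟩⟩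
  have hinj : Function.Injective f := by
    intro g g' h
    have : (f g).2.1 = (f g').2.1 := by rw [h]
    exact Subtype.ext (toWord_injective this)
  refine (Nat.card_le_card_of_injective f hinj).trans ?_
  rw [Nat.card_sigma]
  have hc : ∀ p : Fin (n + 1) × (Fin ℓ × Bool), Nat.card (C p.1 p.2) ≤ (2 * ℓ - 1) ^ n := by
    intro p
    rw [card_chains (fun a => card_successors a) p.2 p.1]
    exact Nat.pow_le_pow_right (by omega) (Nat.lt_succ_iff.1 p.1.2)
  refine (Finset.sum_le_card_nsmul _ _ _ fun p _ => hc p).trans ?_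
  simp [mul_comm]

end Words

namespace EdgePoint

variable {ℓ : ℕ}

theorem vdist_eq_zero {u v : FreeGroup (Fin ℓ)} : vdist u v = 0 ↔ u = v := by
  simp [vdist, inv_mul_eq_one]

theorem vdist_nonneg (u v : FreeGroup (Fin ℓ)) : 0 ≤ vdist u v := Nat.cast_nonneg _

/-- The Gromov product of two vertices of the tree, based at a third one, is the length of a common
prefix of reduced words. -/
theorem vdist_four_point (x y z w : FreeGroup (Fin ℓ)) :
    min (vdist w x + vdist w y - vdist x y) (vdist w y + vdist w z - vdist y z) ≤
      vdist w x + vdist w z - vdist x z := by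
  have key : ∀ u v : FreeGroup (Fin ℓ), vdist w u + vdist w v - vdist u v =
      2 * (commonPrefix (w⁻¹ * u).toWord (w⁻¹ * v).toWord : ℕ) := by
    intro u v
    have h := norm_inv_mul_add _ _ (FreeGroup.isReduced_toWord (x := w⁻¹ * u))
      (FreeGroup.isReduced_toWord (x := w⁻¹ * v))
    rw [FreeGroup.mk_toWord, FreeGroup.mk_toWord] at h
    have e : (w⁻¹ * u)⁻¹ * (w⁻¹ * v) = u⁻¹ * v := by group
    rw [e] at h
    have h' : (((u⁻¹ * v).norm : ℕ) : ℝ) + 2 * (commonPrefix (w⁻¹ * u).toWord (w⁻¹ * v).toWord : ℕ)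
      = ((w⁻¹ * u).norm : ℕ) + ((w⁻¹ * v).norm : ℕ) := by exact_mod_cast h
    unfold vdist
    linarith
  rw [key, key, key]
  have h := commonPrefix_ultrametric (w⁻¹ * x).toWord (w⁻¹ * y).toWord (w⁻¹ * z).toWord
  rcases min_le_iff.1 h with h | h
  · exact min_le_of_left_le (by gcongr)
  · exact min_le_of_right_le (by gcongr)

end EdgePoint

/-! ### Distances in the doubled tree -/

theorem abs_sub_le_of_floor_eq {M : ℕ} (hM : 0 < M) {a b : ℝ} (ha : 0 ≤ a) (hb : 0 ≤ b)
    (h : ⌊a * M⌋₊ = ⌊b * M⌋₊) : |a - b| ≤ 1 / M := by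
  have hM' : (0 : ℝ) < M := by exact_mod_cast hM
  have h1 := Nat.floor_le (mul_nonneg ha hM'.le)
  have h2 := Nat.lt_floor_add_one (a * M)
  have h3 := Nat.floor_le (mul_nonneg hb hM'.le)
  have h4 := Nat.lt_floor_add_one (b * M)
  rw [h] at h1 h2
  rw [abs_le, neg_le, neg_sub, le_div_iff₀ hM', le_div_iff₀ hM', sub_mul, sub_mul]
  constructor <;> linarith

/-- If `B` can be cut into pieces of diameter at most `r`, labelled by the elements of `W`, then
the covering number of `B` at scale `r` is at most the cardinality of `W`. -/
theorem cov_le_card {Y W : Type*} [Finite W] {d : Y → Y → ℝ} {B : Set Y} {r : ℝ} (f : B → W)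
    (h : ∀ y y' : B, f y = f y' → d y y' ≤ r) : cov d B r ≤ (Nat.card W : ℕ∞) := by
  choose g hg using fun w : range f => w.2
  have hS : (range fun w : range f => (g w : Y)) ∈
      {S : Set Y | S ⊆ B ∧ ∀ y ∈ B, ∃ z ∈ S, d y z ≤ r} := by
    refine ⟨?_, fun y hy => ?_⟩
    · rintro _ ⟨w, rfl⟩
      exact (g w).2
    · exact ⟨_, ⟨⟨f ⟨y, hy⟩, mem_range_self _⟩, rfl⟩, h ⟨y, hy⟩ _ (hg ⟨f ⟨y, hy⟩, _⟩).symm⟩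
  refine (iInf₂_le _ hS).trans ?_
  rw [← image_univ]
  refine (encard_image_le _ _).trans ?_
  rw [encard_univ, ← ENat.card_eq_coe_natCard W]
  exact ENat.card_le_card_of_injective Subtype.val_injective

open EdgePoint

namespace DoubledTree

variable {ℓ : ℕ}

/-- The point of the doubled tree represented by a point of an edge. -/
abbrev pt (p : EdgePoint ℓ) : DoubledTree ℓ := SeparationQuotient.mk p

theorem dist_pt (p q : EdgePoint ℓ) : dist (pt p) (pt q) = dist p q :=
  SeparationQuotient.dist_mk p q

theorem arm_nonneg (p : EdgePoint ℓ) (c : Bool) : 0 ≤ p.arm c := by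
  have := p.pos.2.1
  have := p.pos.2.2
  cases c <;> simp [arm] <;> linarith

theorem arm_le_one (p : EdgePoint ℓ) (c : Bool) : p.arm c ≤ 1 := by
  have := p.pos.2.1
  have := p.pos.2.2
  cases c <;> simp [arm] <;> linarith

theorem arm_add_arm_not (p : EdgePoint ℓ) (c : Bool) : p.arm c + p.arm (!c) = 1 := by
  cases c <;> simp [arm]

theorem vdist_endpt_not (p : EdgePoint ℓ) (c : Bool) :
    vdist (p.endpt c) (p.endpt (!c)) = 1 := by
  cases c
  · simpa [endpt] using vdist_edge p.base p.gen
  · simpa [endpt] using (vdist_comm _ _).trans (vdist_edge p.base p.gen)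

theorem dist_pt_le (p q : EdgePoint ℓ) (c c' : Bool) :
    dist (pt p) (pt q) ≤ p.arm c + vdist (p.endpt c) (q.endpt c') + q.arm c' := by
  rw [dist_pt]
  exact (dist_le_outerDist p q).trans (outerDist_le p q c c')

theorem sameEdge_or_exists_dist_pt (p q : EdgePoint ℓ) : SameEdge p q ∨
    ∃ c c', dist (pt p) (pt q) = p.arm c + vdist (p.endpt c) (q.endpt c') + q.arm c' := by
  by_cases h : SameEdge p q
  · exact Or.inl h
  · right
    rw [dist_pt, dist_of_not_same h]
    exact exists_outerDist p q

theorem isometry_edge (b : FreeGroup (Fin ℓ)) (i : Fin ℓ) (c : Bool) :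
    Isometry fun t : Icc (0 : ℝ) 1 => pt (⟨b, i, c, t⟩ : EdgePoint ℓ) :=
  Isometry.of_dist_eq fun t t' => by
    rw [dist_pt]
    exact dist_of_same ⟨rfl, rfl, rfl⟩

theorem isCompact_edges (b : FreeGroup (Fin ℓ)) (n : ℕ) :
    IsCompact {x : DoubledTree ℓ | ∃ p, pt p = x ∧ (b⁻¹ * p.base).norm ≤ n} := by
  have h : IsCompact (⋃ g ∈ {g : FreeGroup (Fin ℓ) | g.norm ≤ n}, ⋃ i : Fin ℓ, ⋃ c : Bool,
      range fun t : Icc (0 : ℝ) 1 => pt (⟨b * g, i, c, t⟩ : EdgePoint ℓ)) :=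
    (finite_norm_le n).isCompact_biUnion fun g _ => isCompact_iUnion fun i =>
      isCompact_iUnion fun c => isCompact_range (isometry_edge _ _ _).continuous
  convert h
  ext x
  simp only [mem_ofPred_eq, mem_iUnion, mem_range]
  constructor
  · rintro ⟨⟨v, i, c, t⟩, rfl, h⟩
    exact ⟨b⁻¹ * v, h, i, c, t, by simp⟩
  · rintro ⟨g, h, i, c, t, rfl⟩
    exact ⟨_, rfl, by simpa using h⟩

variable [NeZero ℓ]

/-- The vertex of the doubled tree given by an element of the free group. -/
def vert (v : FreeGroup (Fin ℓ)) : DoubledTree ℓ := pt ⟨v, 0, false, 0⟩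

theorem dist_vert_le (v : FreeGroup (Fin ℓ)) (p : EdgePoint ℓ) (c : Bool) :
    dist (vert v) (pt p) ≤ vdist v (p.endpt c) + p.arm c := by
  simpa [vert, arm, endpt] using dist_pt_le ⟨v, 0, false, 0⟩ p false c

theorem exists_dist_vert (v : FreeGroup (Fin ℓ)) (p : EdgePoint ℓ) :
    ∃ c, dist (vert v) (pt p) = vdist v (p.endpt c) + p.arm c := by
  rcases sameEdge_or_exists_dist_pt ⟨v, 0, false, 0⟩ p with h | ⟨c, c', h⟩
  · refine ⟨false, ?_⟩
    have h1 : v = p.base := h.1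
    have := p.pos.2.1
    rw [vert, dist_pt, dist_of_same h]
    simpa [endpt, arm, h1, vdist_self] using this
  · refine ⟨c', le_antisymm (dist_vert_le _ _ _) ?_⟩
    rw [vert, h]
    cases c
    · simp [endpt, arm]
    · have h1 := vdist_triangle v (v * FreeGroup.of 0) (p.endpt c')
      rw [vdist_edge] at h1
      simp only [endpt, arm, if_true, Icc.coe_zero] at h1 ⊢
      linarith

theorem dist_vert_endpt (p : EdgePoint ℓ) (c : Bool) :
    dist (vert (p.endpt c)) (pt p) = p.arm c := by
  apply le_antisymm
  · simpa [vdist_self] using dist_vert_le (p.endpt c) p c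
  · obtain ⟨c', h⟩ := exists_dist_vert (p.endpt c) p
    rw [h]
    rcases Bool.eq_or_eq_not c' c with rfl | rfl
    · simp [vdist_self]
    · rw [vdist_endpt_not]
      linarith [arm_nonneg p (!c), arm_le_one p c]

theorem pt_eq_vert {p : EdgePoint ℓ} {c : Bool} (h : p.arm c = 0) : pt p = vert (p.endpt c) := by
  rw [eq_comm, ← dist_eq_zero, dist_vert_endpt, h]

theorem dist_vert (u v : FreeGroup (Fin ℓ)) : dist (vert u) (vert v) = vdist u v := by
  obtain ⟨c, h⟩ := exists_dist_vert u ⟨v, 0, false, 0⟩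
  have h' := dist_vert_le u ⟨v, 0, false, 0⟩ false
  apply le_antisymm
  · simpa [vert, endpt, arm] using h'
  · rw [vert, vert] at *
    rw [h]
    have h1 := vdist_triangle u (v * FreeGroup.of 0) v
    rw [vdist_comm (v * _) v, vdist_edge v] at h1
    cases c
    · simp [endpt, arm]
    · simpa [endpt, arm] using h1

theorem vert_injective : Function.Injective (vert : FreeGroup (Fin ℓ) → DoubledTree ℓ) := by
  intro u v h
  rw [← dist_eq_zero, dist_vert, vdist_eq_zero] at h
  exact h

theorem dist_vert_base_le (p : EdgePoint ℓ) : dist (vert p.base) (pt p) ≤ 1 :=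
  (dist_vert_endpt p false).trans_le (arm_le_one p false)

/-- The doubled tree is at bounded distance from the free group with its word metric. -/
theorem abs_dist_sub_vdist_le (p q : EdgePoint ℓ) :
    |dist (pt p) (pt q) - vdist p.base q.base| ≤ 2 := by
  have h1 := dist_vert_base_le p
  have h2 := dist_vert_base_le q
  have h3 := dist_triangle4 (pt p) (vert p.base) (vert q.base) (pt q)
  have h4 := dist_triangle4 (vert p.base) (pt p) (pt q) (vert q.base)
  rw [dist_comm (pt p) (vert _), dist_vert] at h3
  rw [dist_comm (pt q) (vert _), dist_vert] at h4
  rw [abs_le]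
  constructor <;> linarith

/-! ### Properness and bounded geometry -/

theorem norm_base_le {p q : EdgePoint ℓ} {R : ℝ} (h : dist (pt q) (pt p) ≤ R) :
    (p.base⁻¹ * q.base).norm ≤ ⌊R + 2⌋₊ := by
  refine Nat.le_floor ?_
  have := abs_le.1 (abs_dist_sub_vdist_le p q)
  rw [dist_comm (pt p)] at this
  change vdist _ _ ≤ _
  linarith

instance properSpace : ProperSpace (DoubledTree ℓ) where
  isCompact_closedBall x R := by
    obtain ⟨p, rfl⟩ := SeparationQuotient.surjective_mk x
    refine (isCompact_edges p.base ⌊R + 2⌋₊).of_isClosed_subset Metric.isClosed_closedBall ?_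
    intro y hy
    obtain ⟨q, rfl⟩ := SeparationQuotient.surjective_mk y
    exact ⟨q, rfl, norm_base_le hy⟩

theorem hasBoundedGeometry : HasBoundedGeometry (DoubledTree ℓ) := by
  intro r R hr _
  set N := ⌊R + 2⌋₊
  set M := ⌈1 / r⌉₊
  have hM : 0 < M := Nat.ceil_pos.2 (by positivity)
  have hMr : 1 / (M : ℝ) ≤ r := by
    rw [div_le_comm₀ (by exact_mod_cast hM) hr]
    exact Nat.le_ceil _
  have : Finite {g : FreeGroup (Fin ℓ) // g.norm ≤ N} := (finite_norm_le N).to_subtype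
  let W := {g : FreeGroup (Fin ℓ) // g.norm ≤ N} × Fin ℓ × Bool × Fin (M + 1)
  refine (iSup_le fun x => ?_).trans_lt (ENat.natCast_lt_top (Nat.card W))
  obtain ⟨p, rfl⟩ := SeparationQuotient.surjective_mk x
  choose rep hrep using SeparationQuotient.surjective_mk (X := EdgePoint ℓ)
  refine cov_le_card (fun y => (⟨⟨p.base⁻¹ * (rep y).base, norm_base_le ?_⟩, (rep y).gen,
    (rep y).copy, ⟨⌊((rep y).pos : ℝ) * M⌋₊, ?_⟩⟩ : W)) ?_
  · rw [pt, hrep]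
    exact y.2
  · rw [Nat.lt_succ_iff]
    refine Nat.floor_le_of_le ?_
    exact mul_le_of_le_one_left (Nat.cast_nonneg _) (rep y).pos.2.2
  · intro y y' h
    have h1 := congrArg (fun w : W => w.1.1) h
    have h2 := congrArg (fun w : W => w.2.1) h
    have h3 := congrArg (fun w : W => w.2.2.1) h
    have h4 := congrArg (fun w : W => (w.2.2.2 : ℕ)) h
    have h1 := mul_left_cancel h1
    rw [← hrep y, ← hrep y', SeparationQuotient.dist_mk, dist_of_same ⟨h1, h2, h3⟩]
    exact (abs_sub_le_of_floor_eq hM (rep y).pos.2.1 (rep y').pos.2.1 h4).trans hMr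

/-! ### Hyperbolicity -/

theorem isGromovHyperbolic : IsGromovHyperbolic (DoubledTree ℓ) := by
  refine ⟨6, by norm_num, fun x y z w => ?_⟩
  obtain ⟨x, rfl⟩ := SeparationQuotient.surjective_mk x
  obtain ⟨y, rfl⟩ := SeparationQuotient.surjective_mk y
  obtain ⟨z, rfl⟩ := SeparationQuotient.surjective_mk z
  obtain ⟨w, rfl⟩ := SeparationQuotient.surjective_mk w
  have h := vdist_four_point x.base y.base z.base w.base
  have hwx := abs_le.1 (abs_dist_sub_vdist_le w x)
  have hwy := abs_le.1 (abs_dist_sub_vdist_le w y)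
  have hwz := abs_le.1 (abs_dist_sub_vdist_le w z)
  have hxy := abs_le.1 (abs_dist_sub_vdist_le x y)
  have hyz := abs_le.1 (abs_dist_sub_vdist_le y z)
  have hxz := abs_le.1 (abs_dist_sub_vdist_le x z)
  rw [sub_le_iff_le_add]
  unfold gromovProd
  rcases min_le_iff.1 h with h | h
  · exact min_le_of_left_le (by linarith)
  · exact min_le_of_right_le (by linarith)

/-! ### Geodesics -/

end DoubledTree

/-- There is a geodesic segment from `x` to `y`. -/
def GeodesicallyJoined {X : Type*} [MetricSpace X] (x y : X) : Prop :=
  ∃ γ : ℝ → X, γ 0 = x ∧ γ (dist x y) = y ∧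
    ∀ s ∈ Icc (0 : ℝ) (dist x y), ∀ t ∈ Icc (0 : ℝ) (dist x y), dist (γ s) (γ t) = |s - t|

theorem GeodesicallyJoined.symm {X : Type*} [MetricSpace X] {x y : X}
    (h : GeodesicallyJoined x y) : GeodesicallyJoined y x := by
  obtain ⟨γ, h0, h1, h⟩ := h
  refine ⟨fun t => γ (dist x y - t), by simpa using h1, by simpa [dist_comm y x] using h0, ?_⟩
  intro s hs t ht
  rw [dist_comm y x] at hs ht
  rw [h _ ⟨by linarith [hs.2], by linarith [hs.1]⟩ _ ⟨by linarith [ht.2], by linarith [ht.1]⟩,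
    abs_sub_comm]
  congr 1
  ring

theorem GeodesicallyJoined.trans {X : Type*} [MetricSpace X] {x y z : X}
    (h : GeodesicallyJoined x y) (h' : GeodesicallyJoined y z)
    (hd : dist x z = dist x y + dist y z) : GeodesicallyJoined x z := by
  obtain ⟨γ, h0, h1, h⟩ := h
  obtain ⟨γ', h0', h1', h'⟩ := h'
  have hxy := dist_nonneg (x := x) (y := y)
  have hyz := dist_nonneg (x := y) (y := z)
  set a := dist x y
  set b := dist y z
  let δ : ℝ → X := fun t => if t ≤ a then γ t else γ' (t - a)
  have key : ∀ s t : ℝ, 0 ≤ s → s ≤ a → a < t → t ≤ a + b → dist (γ s) (γ' (t - a)) = t - s := by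
    intro s t hs hsa hat htb
    have e1 := h s ⟨hs, hsa⟩ a ⟨hxy, le_rfl⟩
    have e2 := h' 0 ⟨le_rfl, hyz⟩ (t - a) ⟨by linarith, by linarith⟩
    have e3 := h 0 ⟨le_rfl, hxy⟩ s ⟨hs, hsa⟩
    have e4 := h' (t - a) ⟨by linarith, by linarith⟩ b ⟨hyz, le_rfl⟩
    rw [abs_of_nonpos (by linarith)] at e1 e2 e3 e4
    rw [h1] at e1
    rw [h0'] at e2
    rw [h0] at e3
    rw [h1'] at e4
    have t1 := dist_triangle (γ s) y (γ' (t - a))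
    have t2 := dist_triangle4 x (γ s) (γ' (t - a)) z
    apply le_antisymm <;> linarith
  refine ⟨δ, by simp [δ, hxy, h0], ?_, ?_⟩
  · rw [hd]
    by_cases hb : b = 0
    · have : y = z := dist_eq_zero.1 hb
      simp [δ, hb, h1, this]
    · have : 0 < b := lt_of_le_of_ne hyz (Ne.symm hb)
      simp [δ, this, h1']
  · rw [hd]
    rintro s ⟨hs0, hs⟩ t ⟨ht0, ht⟩
    by_cases hsa : s ≤ a <;> by_cases hta : t ≤ a
    · simpa [δ, hsa, hta] using h s ⟨hs0, hsa⟩ t ⟨ht0, hta⟩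
    · push Not at hta
      simp only [δ, hsa, hta.not_ge, if_true, if_false]
      rw [key s t hs0 hsa hta ht, abs_of_nonpos (by linarith)]
      ring
    · push Not at hsa
      simp only [δ, hta, hsa.not_ge, if_true, if_false]
      rw [dist_comm, key t s ht0 hta hsa hs, abs_of_nonneg (by linarith)]
    · push Not at hsa hta
      simp only [δ, hsa.not_ge, hta.not_ge, if_false]
      rw [h' _ ⟨by linarith, by linarith⟩ _ ⟨by linarith, by linarith⟩]
      congr 1
      ring

namespace DoubledTree

variable {ℓ : ℕ}

theorem joined_of_sameEdge {p q : EdgePoint ℓ} (h : SameEdge p q) :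
    GeodesicallyJoined (pt p) (pt q) := by
  wlog hpq : (p.pos : ℝ) ≤ q.pos generalizing p q
  · exact (this h.symm (le_of_not_ge hpq)).symm
  obtain ⟨b, i, c, s, hs⟩ := p
  obtain ⟨b', i', c', t, ht⟩ := q
  obtain ⟨rfl, rfl, rfl⟩ : b = b' ∧ i = i' ∧ c = c' := h
  change s ≤ t at hpq
  have hd : dist (pt ⟨b, i, c, ⟨s, hs⟩⟩) (pt ⟨b, i, c, ⟨t, ht⟩⟩) = t - s := by
    rw [(isometry_edge b i c).dist_eq, Subtype.dist_eq, Real.dist_eq, abs_sub_comm]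
    exact abs_of_nonneg (sub_nonneg.2 hpq)
  unfold GeodesicallyJoined
  rw [hd]
  refine ⟨fun u => pt ⟨b, i, c, projIcc 0 1 zero_le_one (s + u)⟩, ?_, ?_, ?_⟩
  · simp [projIcc_of_mem _ hs]
  · simp [projIcc_of_mem _ ht]
  · rintro u ⟨hu, hu'⟩ v ⟨hv, hv'⟩
    rw [(isometry_edge b i c).dist_eq, Subtype.dist_eq, Real.dist_eq]
    rw [projIcc_of_mem _ ⟨by linarith [hs.1], by linarith [ht.2]⟩,
      projIcc_of_mem _ ⟨by linarith [hs.1], by linarith [ht.2]⟩]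
    simp

variable [NeZero ℓ]

theorem joined_vert_endpt (p : EdgePoint ℓ) (c : Bool) :
    GeodesicallyJoined (vert (p.endpt c)) (pt p) := by
  have h : ∃ q : EdgePoint ℓ, SameEdge q p ∧ pt q = vert (p.endpt c) := by
    cases c
    · exact ⟨⟨p.base, p.gen, p.copy, 0⟩, ⟨rfl, rfl, rfl⟩, pt_eq_vert (c := false) (by simp [arm])⟩
    · exact ⟨⟨p.base, p.gen, p.copy, 1⟩, ⟨rfl, rfl, rfl⟩, pt_eq_vert (c := true) (by simp [arm])⟩
  obtain ⟨q, hq, e⟩ := h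
  rw [← e]
  exact joined_of_sameEdge hq

/-- Reading a reduced word from `u` gives a geodesic, since each letter increases the distance to `u`
by one. -/
theorem joined_vert_mul (L : List (Fin ℓ × Bool)) (hL : FreeGroup.IsReduced L)
    (u : FreeGroup (Fin ℓ)) : GeodesicallyJoined (vert u) (vert (u * FreeGroup.mk L)) := by
  induction L generalizing u with
  | nil =>
    have : FreeGroup.mk ([] : List (Fin ℓ × Bool)) = 1 := rfl
    rw [this, mul_one]
    exact joined_of_sameEdge ⟨rfl, rfl, rfl⟩
  | cons a L ih =>
    have e : u * FreeGroup.mk (a :: L) = u * FreeGroup.mk [a] * FreeGroup.mk L := by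
      rw [mul_assoc, FreeGroup.mul_mk]
      rfl
    have h1 : ∀ (i : Fin ℓ) (v : FreeGroup (Fin ℓ)),
        GeodesicallyJoined (vert v) (vert (v * FreeGroup.of i)) := fun i v => by
      have h := joined_vert_endpt ⟨v, i, false, 1⟩ false
      rwa [pt_eq_vert (c := true) (by simp [arm])] at h
    rw [e]
    refine GeodesicallyJoined.trans (y := vert (u * FreeGroup.mk [a])) ?_
      (ih (hL.infix (List.suffix_cons a L).isInfix) _) ?_
    · obtain ⟨i, s⟩ := a
      cases s
      · have h := (h1 i (u * (FreeGroup.of i)⁻¹)).symm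
        rw [inv_mul_cancel_right] at h
        exact h
      · exact h1 i u
    · rw [← e, dist_vert, dist_vert, dist_vert, e]
      unfold vdist
      rw [inv_mul_cancel_left, inv_mul_cancel_left, ← e, inv_mul_cancel_left,
        norm_mk_of_isReduced hL, norm_mk_of_isReduced (FreeGroup.IsReduced.singleton),
        norm_mk_of_isReduced (hL.infix (List.suffix_cons a L).isInfix)]
      push_cast [List.length_cons, List.length_nil]
      ring

theorem isGeodesicSpace : IsGeodesicSpace (DoubledTree ℓ) := by
  intro x y
  obtain ⟨p, rfl⟩ := SeparationQuotient.surjective_mk x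
  obtain ⟨q, rfl⟩ := SeparationQuotient.surjective_mk y
  change GeodesicallyJoined (pt p) (pt q)
  rcases sameEdge_or_exists_dist_pt p q with h | ⟨c, c', h⟩
  · exact joined_of_sameEdge h
  · have h1 : GeodesicallyJoined (vert (p.endpt c)) (vert (q.endpt c')) := by
      have := joined_vert_mul _ (FreeGroup.isReduced_toWord (x := (p.endpt c)⁻¹ * q.endpt c'))
        (p.endpt c)
      rwa [FreeGroup.mk_toWord, mul_inv_cancel_left] at this
    have e1 := dist_vert_endpt p c
    have e2 := dist_vert_endpt q c'
    have e3 := dist_vert (p.endpt c) (q.endpt c')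
    have t1 := dist_triangle (pt p) (vert (p.endpt c)) (vert (q.endpt c'))
    have t2 := dist_triangle (pt p) (vert (q.endpt c')) (pt q)
    rw [dist_comm (pt p) (vert (p.endpt c))] at t1
    have e4 : dist (pt p) (vert (q.endpt c')) =
        dist (pt p) (vert (p.endpt c)) + dist (vert (p.endpt c)) (vert (q.endpt c')) := by
      rw [dist_comm (pt p) (vert (p.endpt c))]
      linarith
    refine ((joined_vert_endpt p c).symm.trans h1 e4).trans (joined_vert_endpt q c') ?_
    rw [e4, dist_comm (pt p) (vert (p.endpt c))]
    linarith

end DoubledTree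

namespace DoubledTree

variable {ℓ : ℕ}

/-! ### The action of the free group -/

theorem action_pt (g : FreeGroup (Fin ℓ)) (p : EdgePoint ℓ) : action ℓ g (pt p) = pt (g • p) := rfl

theorem eq_one_of_action_eq {g : FreeGroup (Fin ℓ)} {x : DoubledTree ℓ} (h : action ℓ g x = x) :
    g = 1 := by
  obtain ⟨p, rfl⟩ := SeparationQuotient.surjective_mk x
  have h0 : dist (pt (g • p)) (pt p) = 0 := dist_eq_zero.2 h
  rcases sameEdge_or_exists_dist_pt (g • p) p with hs | ⟨c, c', hc⟩
  · exact mul_eq_right.1 (show g * p.base = p.base from hs.1)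
  · have e : (g • p).arm c = p.arm c := rfl
    have h1 := arm_nonneg p c
    have h2 := arm_nonneg p c'
    have h3 := vdist_nonneg ((g • p).endpt c) (p.endpt c')
    have hcc : c' = c := by
      by_contra hne
      have := arm_add_arm_not p c
      rw [Bool.eq_not_of_ne hne] at h2 h3 hc
      linarith
    subst hcc
    have h4 := vdist_eq_zero.1 (show vdist ((g • p).endpt c') (p.endpt c') = 0 by linarith)
    rw [endpt_smul] at h4
    exact mul_eq_right.1 h4

theorem isFreeGroupAction : IsFreeGroupAction (freeIsomGroup ℓ) := by
  rintro _ ⟨g, rfl⟩ x h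
  rw [eq_one_of_action_eq h, map_one]

theorem action_eq_one_iff [NeZero ℓ] {g : FreeGroup (Fin ℓ)} : action ℓ g = 1 ↔ g = 1 :=
  ⟨fun h => eq_one_of_action_eq (x := vert 1) (by rw [h]; rfl), fun h => by rw [h, map_one]⟩

theorem action_injective [NeZero ℓ] : Function.Injective (action ℓ) :=
  (injective_iff_map_eq_one _).2 fun _ h => action_eq_one_iff.1 h

theorem isTorsionFreeGroup [NeZero ℓ] : IsTorsionFreeGroup (freeIsomGroup ℓ) := by
  rintro _ ⟨g, rfl⟩ h
  obtain ⟨n, hn, h⟩ := isOfFinOrder_iff_pow_eq_one.1 h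
  rw [← map_pow, action_eq_one_iff] at h
  rw [(pow_eq_one_iff_left hn.ne').1 h, map_one]

/-- The elements moving the vertex `b` by at most `n`. -/
def displacementLE (b : FreeGroup (Fin ℓ)) (n : ℕ) : Set (FreeGroup (Fin ℓ)) :=
  {g | (b⁻¹ * (g * b)).norm ≤ n}

theorem displacementLE_eq (b : FreeGroup (Fin ℓ)) (n : ℕ) :
    displacementLE b n = MulAut.conj b '' {g | g.norm ≤ n} := by
  ext g
  constructor
  · intro h
    exact ⟨b⁻¹ * (g * b), h, by simp [MulAut.conj_apply, mul_assoc]⟩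
  · rintro ⟨g, h, rfl⟩
    have : b⁻¹ * (MulAut.conj b g * b) = g := by simp [MulAut.conj_apply, mul_assoc]
    rw [displacementLE, mem_ofPred_eq, this]
    exact h

theorem finite_displacementLE (b : FreeGroup (Fin ℓ)) (n : ℕ) : (displacementLE b n).Finite := by
  rw [displacementLE_eq]
  exact (finite_norm_le n).image _

theorem encard_displacementLE (b : FreeGroup (Fin ℓ)) (n : ℕ) :
    (displacementLE b n).encard = (Nat.card {g : FreeGroup (Fin ℓ) // g.norm ≤ n} : ℕ∞) := by
  rw [displacementLE_eq, (MulAut.conj b).injective.encard_image, ← (finite_norm_le n).cast_ncard_eq]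
  rfl

theorem mem_displacementLE [NeZero ℓ] {p : EdgePoint ℓ} {g : FreeGroup (Fin ℓ)} {R : ℝ}
    (h : dist (action ℓ g (pt p)) (pt p) ≤ R) : g ∈ displacementLE p.base ⌊R + 2⌋₊ := by
  rw [action_pt] at h
  exact norm_base_le h

theorem isDiscreteGroup [NeZero ℓ] : IsDiscreteGroup (freeIsomGroup ℓ) := by
  intro x R
  obtain ⟨p, rfl⟩ := SeparationQuotient.surjective_mk x
  refine ((finite_displacementLE p.base ⌊R + 2⌋₊).image (action ℓ)).subset ?_
  rintro _ ⟨⟨g, rfl⟩, h⟩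
  exact ⟨g, mem_displacementLE h, rfl⟩

theorem isCocompactGroup [NeZero ℓ] : IsCocompactGroup (freeIsomGroup ℓ) := by
  have h := (isCompact_edges (1 : FreeGroup (Fin ℓ)) 0).image
    (continuous_quotient_mk' (s := orbitSetoid (freeIsomGroup ℓ)))
  refine isCompact_univ_iff.1 (h.of_isClosed_subset isClosed_univ fun y _ => ?_)
  obtain ⟨x, rfl⟩ := Quotient.exists_rep y
  obtain ⟨p, rfl⟩ := SeparationQuotient.surjective_mk x
  refine ⟨pt (p.base⁻¹ • p), ⟨_, rfl, ?_⟩, Quotient.sound ⟨action ℓ p.base, ⟨_, rfl⟩, ?_⟩⟩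
  · change (1⁻¹ * (p.base⁻¹ * p.base)).norm ≤ 0
    simp
  · rw [action_pt, smul_inv_smul]

/-! ### The critical exponent -/

theorem ennreal_log_natCast {n : ℕ} (hn : n ≠ 0) :
    ENNReal.log (((n : ℕ∞) : ℝ≥0∞)) = ((Real.log n : ℝ) : EReal) := by
  have : (((n : ℕ∞) : ℝ≥0∞)) = ENNReal.ofReal (n : ℝ) := by simp
  rw [this, ENNReal.log_ofReal_of_pos (by positivity)]

theorem tendsto_log_upper (m k : ℝ) :
    Tendsto (fun T : ℝ => (Real.log (T + 3) + k + (T + 2) * m) / T) atTop (𝓝 m) := by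
  have h1 : Tendsto (fun T : ℝ => Real.log (T + 3) ^ 1 / (1 * (T + 3) + (-3))) atTop (𝓝 0) :=
    (Real.tendsto_pow_log_div_mul_add_atTop 1 (-3) 1 one_ne_zero).comp
      (tendsto_atTop_add_const_right _ 3 tendsto_id)
  have h2 : Tendsto (fun T : ℝ => (k + 2 * m) / T) atTop (𝓝 0) :=
    tendsto_const_nhds.div_atTop tendsto_id
  have h3 := (h1.add h2).add_const m
  rw [zero_add, zero_add] at h3
  refine h3.congr' ?_
  filter_upwards [eventually_gt_atTop 0] with T hT
  have e : 1 * (T + 3) + -3 = T := by ring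
  rw [e]
  field_simp
  ring

theorem tendsto_log_lower (m : ℝ) :
    Tendsto (fun T : ℝ => (T - 4) * m / T) atTop (𝓝 m) := by
  have h2 : Tendsto (fun T : ℝ => -(4 * m) / T) atTop (𝓝 0) :=
    tendsto_const_nhds.div_atTop tendsto_id
  have h3 := h2.add_const m
  rw [zero_add] at h3
  refine h3.congr' ?_
  filter_upwards [eventually_gt_atTop 0] with T hT
  field_simp
  ring

/-- Displacements of `x` and of the vertex `b` next to it differ by at most `2`, so that the orbit
points in the ball of radius `T` are squeezed between the balls of radii `T - 3` and `T + 2` of the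
free group. -/
theorem critExponent_eq [NeZero ℓ] (x : DoubledTree ℓ) :
    critExponent (freeIsomGroup ℓ) x = ((Real.log (2 * (ℓ : ℝ) - 1) : ℝ) : EReal) := by
  have hℓ : 1 ≤ ℓ := NeZero.one_le
  obtain ⟨p, rfl⟩ := SeparationQuotient.surjective_mk x
  set b := p.base
  set m : ℝ := Real.log (2 * (ℓ : ℝ) - 1)
  have hm : ((2 * ℓ - 1 : ℕ) : ℝ) = 2 * (ℓ : ℝ) - 1 := by
    rw [Nat.cast_sub (by omega)]; push_cast; ring
  have hℓ' : (1 : ℝ) ≤ ℓ := by exact_mod_cast hℓ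
  have hm0 : 0 ≤ m := Real.log_nonneg (by linarith)
  have hup : ∀ᶠ T : ℝ in atTop, ENNReal.log
      (((orbitOf (freeIsomGroup ℓ) (pt p) ∩ Metric.ball (pt p) T).encard : ℕ∞) : ℝ≥0∞) / (T : EReal)
      ≤ (((Real.log (T + 3) + Real.log (2 * ℓ) + (T + 2) * m) / T : ℝ) : EReal) := by
    filter_upwards [eventually_gt_atTop 0] with T hT
    have h1 : (orbitOf (freeIsomGroup ℓ) (pt p) ∩ Metric.ball (pt p) T).encard ≤
        ((((⌊T + 2⌋₊ + 1) * (2 * ℓ) * (2 * ℓ - 1) ^ ⌊T + 2⌋₊ : ℕ) : ℕ∞)) := by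
      refine le_trans ?_ (Nat.cast_le.2 (card_ball_le hℓ ⌊T + 2⌋₊))
      rw [← encard_displacementLE b]
      refine le_trans (encard_le_encard ?_) (encard_image_le (fun g => action ℓ g (pt p)) _)
      rintro _ ⟨⟨_, ⟨g, rfl⟩, rfl⟩, h⟩
      exact ⟨g, mem_displacementLE (le_of_lt h), rfl⟩
    rw [EReal.coe_div]
    refine EReal.div_le_div_right_of_nonneg (by exact_mod_cast hT.le) ?_
    have h2 : (2 * ℓ - 1) ^ ⌊T + 2⌋₊ ≠ 0 := pow_ne_zero _ (by omega)
    refine (ENNReal.log_le_log (ENat.toENNReal_le.2 h1)).trans ?_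
    rw [ennreal_log_natCast (by positivity), EReal.coe_le_coe_iff]
    have hfl : (⌊T + 2⌋₊ : ℝ) ≤ T + 2 := Nat.floor_le (by linarith)
    push_cast [hm]
    rw [Real.log_mul (by positivity) (pow_ne_zero _ (by linarith)),
      Real.log_mul (by positivity) (by positivity), Real.log_pow]
    have h3 : Real.log ((⌊T + 2⌋₊ : ℝ) + 1) ≤ Real.log (T + 3) :=
      Real.log_le_log (by positivity) (by linarith)
    have h4 : (⌊T + 2⌋₊ : ℝ) * m ≤ (T + 2) * m := by gcongr
    linarith
  have hlow : ∀ᶠ T : ℝ in atTop, (((T - 4) * m / T : ℝ) : EReal) ≤ ENNReal.log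
      (((orbitOf (freeIsomGroup ℓ) (pt p) ∩ Metric.ball (pt p) T).encard : ℕ∞) : ℝ≥0∞)
        / (T : EReal) := by
    filter_upwards [eventually_gt_atTop 3] with T hT
    have h1 : ((((2 * ℓ - 1) ^ ⌊T - 3⌋₊ : ℕ) : ℕ∞)) ≤
        (orbitOf (freeIsomGroup ℓ) (pt p) ∩ Metric.ball (pt p) T).encard := by
      refine (Nat.cast_le.2 (pow_le_card_ball hℓ ⌊T - 3⌋₊)).trans ?_
      have hinj : Function.Injective fun g => action ℓ g (pt p) := fun g g' h => by
        have h' : action ℓ (g'⁻¹ * g) (pt p) = pt p := by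
          change action ℓ g (pt p) = action ℓ g' (pt p) at h
          rw [map_mul, IsometryEquiv.mul_apply, h, ← IsometryEquiv.mul_apply, ← map_mul,
            inv_mul_cancel, map_one]
          rfl
        exact (inv_mul_eq_one.1 (eq_one_of_action_eq h')).symm
      rw [← encard_displacementLE b, ← hinj.encard_image]
      refine encard_le_encard ?_
      rintro _ ⟨g, hg, rfl⟩
      refine ⟨⟨_, ⟨g, rfl⟩, rfl⟩, ?_⟩
      have h2 := (abs_le.1 (abs_dist_sub_vdist_le p (g • p))).2
      have h3 : vdist p.base (g • p).base ≤ T - 3 :=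
        (Nat.le_floor_iff (by linarith)).1 (show _ ≤ ⌊T - 3⌋₊ from hg)
      rw [Metric.mem_ball, dist_comm]
      change dist (pt p) (pt (g • p)) < T
      linarith
    rw [EReal.coe_div]
    refine EReal.div_le_div_right_of_nonneg (by exact_mod_cast (by linarith : (0 : ℝ) ≤ T)) ?_
    refine le_trans ?_ (ENNReal.log_le_log (ENat.toENNReal_le.2 h1))
    rw [ennreal_log_natCast (pow_ne_zero _ (by omega)), EReal.coe_le_coe_iff]
    push_cast [hm]
    rw [Real.log_pow]
    have hfl := Nat.lt_floor_add_one (T - 3)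
    gcongr
    linarith
  have hup' := (continuous_coe_real_ereal.tendsto m).comp (tendsto_log_upper m (Real.log (2 * ℓ)))
  have hlow' := (continuous_coe_real_ereal.tendsto m).comp (tendsto_log_lower m)
  exact (tendsto_of_tendsto_of_tendsto_of_le_of_le' hlow' hup' hlow hup).limsup_eq

end DoubledTree

/-! ### The limit set -/

section Boundary

variable {X : Type*} [MetricSpace X]

theorem gromovProd_le_add (x x' y z : X) : gromovProd x y z ≤ gromovProd x' y z + dist x x' := by
  unfold gromovProd
  have h1 := dist_triangle x x' y
  have h2 := dist_triangle x x' z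
  linarith

theorem abs_gromovProd_sub_le (w x y x' y' : X) :
    |gromovProd w x y - gromovProd w x' y'| ≤ dist x x' + dist y y' := by
  unfold gromovProd
  have h1 := dist_triangle w x' x
  have h1' := dist_triangle w x x'
  have h2 := dist_triangle w y' y
  have h2' := dist_triangle w y y'
  have h3 := dist_triangle4 x x' y' y
  have h3' := dist_triangle4 x' x y y'
  rw [dist_comm x' x] at *
  rw [dist_comm y' y] at *
  rw [abs_le]
  constructor <;> linarith

/-- The Gromov products of two sequences tend to infinity. -/
def GromovAsymptotic (z z' : ℕ → X) : Prop :=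
  ∀ x : X, Tendsto (fun p : ℕ × ℕ => gromovProd x (z p.1) (z' p.2)) atTop atTop

theorem gromovAsymptotic_iff (x : X) {z z' : ℕ → X} : GromovAsymptotic z z' ↔
    ∀ M : ℝ, ∃ N, ∀ n ≥ N, ∀ k ≥ N, M ≤ gromovProd x (z n) (z' k) := by
  constructor
  · intro h M
    obtain ⟨⟨a, b⟩, hab⟩ := eventually_atTop.1 ((h x).eventually_ge_atTop M)
    exact ⟨max a b, fun n hn k hk =>
      hab (n, k) ⟨(le_max_left _ _).trans hn, (le_max_right _ _).trans hk⟩⟩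
  · intro h y
    refine tendsto_atTop.2 fun M => ?_
    obtain ⟨N, hN⟩ := h (M + dist x y)
    filter_upwards [eventually_ge_atTop (N, N)] with p hp
    have h1 := hN p.1 hp.1 p.2 hp.2
    have h2 := gromovProd_le_add x y (z p.1) (z' p.2)
    linarith

theorem GromovAsymptotic.symm {z z' : ℕ → X} (h : GromovAsymptotic z z') :
    GromovAsymptotic z' z := by
  intro x
  refine (gromovAsymptotic_iff x).2 (fun M => ?_) x
  obtain ⟨N, hN⟩ := (gromovAsymptotic_iff x).1 h M
  refine ⟨N, fun n hn k hk => (hN k hk n hn).trans_eq ?_⟩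
  unfold gromovProd
  rw [dist_comm (z k), add_comm]

theorem GromovAsymptotic.trans (hX : IsGromovHyperbolic X) {z z' z'' : ℕ → X}
    (h : GromovAsymptotic z z') (h' : GromovAsymptotic z' z'') : GromovAsymptotic z z'' := by
  obtain ⟨δ, -, hδ⟩ := hX
  intro x
  refine (gromovAsymptotic_iff x).2 (fun M => ?_) x
  obtain ⟨N, hN⟩ := (gromovAsymptotic_iff x).1 h (M + δ)
  obtain ⟨N', hN'⟩ := (gromovAsymptotic_iff x).1 h' (M + δ)
  refine ⟨max N N', fun n hn k hk => ?_⟩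
  have h1 := hN n ((le_max_left _ _).trans hn) _ (le_max_left N N')
  have h2 := hN' _ (le_max_right N N') k ((le_max_right _ _).trans hk)
  have h3 := hδ (z n) (z' (max N N')) (z'' k) x
  have h4 := le_min h1 h2
  linarith

/-- In a hyperbolic space, sequences defining the same boundary point are asymptotic. -/
theorem gromovBoundary_mk_eq (hX : IsGromovHyperbolic X) {z z' : GromovSeq X}
    (h : (Quot.mk _ z : GromovBoundary X) = Quot.mk _ z') : GromovAsymptotic z.1 z'.1 := by
  have he : Equivalence fun z z' : GromovSeq X => GromovAsymptotic z.1 z'.1 :=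
    ⟨fun z => z.2, fun h => h.symm, fun h h' => h.trans hX h'⟩
  exact (he.quot_mk_eq_iff z z').1 h

end Boundary

namespace DoubledTree

variable {ℓ : ℕ}

/-- The orbit point `aⁿ x`, where the pair `a` stands for a generator (second component `true`) or
the inverse of one (second component `false`). -/
def ray (x : DoubledTree ℓ) (a : Fin ℓ × Bool) (n : ℕ) : DoubledTree ℓ :=
  action ℓ (FreeGroup.mk (List.replicate n a)) x

theorem commonPrefix_replicate (a b : Fin ℓ × Bool) (n k : ℕ) :
    commonPrefix (List.replicate n a) (List.replicate k b) = if a = b then min n k else 0 := by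
  induction n generalizing k with
  | zero => simp [commonPrefix]
  | succ n ih =>
    rcases k with _ | k
    · simp [commonPrefix]
    · simp only [List.replicate_succ, commonPrefix, ih]
      split_ifs <;> omega

variable [NeZero ℓ]

/-- The Gromov products of points of these rays are, up to an additive constant, the lengths of the
common prefixes of the corresponding powers. -/
theorem abs_gromovProd_ray_sub_le (x : DoubledTree ℓ) (a b : Fin ℓ × Bool) (n k : ℕ) :
    |gromovProd (vert 1) (ray x a n) (ray x b k) - ((if a = b then min n k else 0 : ℕ) : ℝ)| ≤
      dist x (vert 1) + dist x (vert 1) := by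
  have hv : ∀ (a : Fin ℓ × Bool) n, dist (ray x a n) (vert (FreeGroup.mk (List.replicate n a))) =
      dist x (vert 1) := by
    intro a n
    have h : vert (FreeGroup.mk (List.replicate n a)) =
        action ℓ (FreeGroup.mk (List.replicate n a)) (vert 1) := by
      change _ = vert (_ * 1)
      rw [mul_one]
    rw [h, ray, IsometryEquiv.dist_eq]
  have hr : ∀ (a : Fin ℓ × Bool) n, FreeGroup.IsReduced (List.replicate n a) := fun a n =>
    List.isChain_replicate_of_rel n fun _ => rfl
  have hg : gromovProd (vert (1 : FreeGroup (Fin ℓ))) (vert (FreeGroup.mk (List.replicate n a)))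
      (vert (FreeGroup.mk (List.replicate k b))) = ((if a = b then min n k else 0 : ℕ) : ℝ) := by
    have h := norm_inv_mul_add _ _ (hr a n) (hr b k)
    rw [commonPrefix_replicate] at h
    have h' : (((FreeGroup.mk (List.replicate n a))⁻¹ *
        FreeGroup.mk (List.replicate k b)).norm : ℝ) +
        2 * ((if a = b then min n k else 0 : ℕ) : ℝ) = (n : ℝ) + (k : ℝ) := by
      have h2 := congrArg (Nat.cast : ℕ → ℝ) h
      simpa only [Nat.cast_add, Nat.cast_mul, List.length_replicate, Nat.cast_two] using h2
    unfold gromovProd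
    rw [dist_vert, dist_vert, dist_vert]
    unfold vdist
    rw [inv_one, one_mul, one_mul, norm_mk_of_isReduced (hr a n), norm_mk_of_isReduced (hr b k),
      List.length_replicate, List.length_replicate]
    linarith
  rw [← hg]
  refine (abs_gromovProd_sub_le _ _ _ _ _).trans_eq ?_
  rw [hv, hv]

theorem gromovAsymptotic_ray_iff (x : DoubledTree ℓ) (a b : Fin ℓ × Bool) :
    GromovAsymptotic (ray x a) (ray x b) ↔ a = b := by
  rw [gromovAsymptotic_iff (vert 1)]
  constructor
  · intro h
    by_contra hab
    obtain ⟨N, hN⟩ := h (dist x (vert 1) + dist x (vert 1) + 1)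
    have h1 := hN N le_rfl N le_rfl
    have h2 := (abs_le.1 (abs_gromovProd_ray_sub_le x a b N N)).2
    rw [if_neg hab, Nat.cast_zero] at h2
    linarith
  · rintro rfl M
    refine ⟨⌈M + (dist x (vert 1) + dist x (vert 1))⌉₊, fun n hn k hk => ?_⟩
    have h2 := (abs_le.1 (abs_gromovProd_ray_sub_le x a a n k)).1
    have h3 := (Nat.le_ceil _).trans (Nat.cast_le (α := ℝ).2 (le_min hn hk))
    rw [if_pos rfl] at h2
    linarith

/-- The sequence `ray x a`, which tends to infinity. -/
def raySeq (x : DoubledTree ℓ) (a : Fin ℓ × Bool) : GromovSeq (DoubledTree ℓ) :=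
  ⟨ray x a, (gromovAsymptotic_ray_iff x a a).2 rfl⟩

/-- The point of the Gromov boundary defined by `ray x a`. -/
def rayEnd (x : DoubledTree ℓ) (a : Fin ℓ × Bool) : GromovBoundary (DoubledTree ℓ) :=
  Quot.mk _ (raySeq x a)

theorem rayEnd_injective (x : DoubledTree ℓ) : Function.Injective (rayEnd x) := by
  intro a b h
  have h' : GromovAsymptotic (raySeq x a).1 (raySeq x b).1 :=
    gromovBoundary_mk_eq isGromovHyperbolic h
  exact (gromovAsymptotic_ray_iff x a b).1 h'

theorem rayEnd_mem_limitSet (x : DoubledTree ℓ) (a : Fin ℓ × Bool) :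
    rayEnd x a ∈ limitSet (freeIsomGroup ℓ) x :=
  ⟨raySeq x a, fun _ => ⟨_, ⟨_, rfl⟩, rfl⟩, rfl⟩

theorem isNonElementary (hℓ : 2 ≤ ℓ) : IsNonElementary (freeIsomGroup ℓ) := by
  intro x
  have hsub : range (rayEnd x) ⊆ limitSet (freeIsomGroup ℓ) x := by
    rintro _ ⟨a, rfl⟩
    exact rayEnd_mem_limitSet x a
  refine lt_of_lt_of_le ?_ (encard_le_encard hsub)
  rw [← image_univ, (rayEnd_injective x).encard_image, encard_univ, ENat.card_eq_coe_natCard]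
  have h : 2 < Nat.card (Fin ℓ × Bool) := by
    rw [Nat.card_prod, Nat.card_eq_fintype_card, Nat.card_eq_fintype_card, Fintype.card_fin,
      Fintype.card_bool]
    omega
  exact Nat.cast_lt.2 h

end DoubledTree

/-! ### Subshifts -/

/-- The bi-infinite sequences in which every letter is an `R`-successor of the preceding one. -/
abbrev Subshift {A : Type*} (R : A → A → Prop) : Type _ :=
  {σ : ℤ → A // ∀ k, R (σ k) (σ (k + 1))}

namespace Subshift

variable {A : Type*} {R : A → A → Prop}

/-- The shift map. -/
def shift (σ : Subshift R) : Subshift R :=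
  ⟨fun k => σ.1 (k + 1), fun k => σ.2 (k + 1)⟩

theorem shift_iterate (σ : Subshift R) (n : ℕ) (k : ℤ) : (shift^[n] σ).1 k = σ.1 (k + n) := by
  induction n generalizing σ with
  | zero => simp
  | succ n ih =>
    rw [Function.iterate_succ_apply, ih]
    change σ.1 (k + n + 1) = _
    rw [Nat.cast_succ, add_assoc]

variable [TopologicalSpace A] [DiscreteTopology A]

theorem eventually_eq (σ : Subshift R) (k : ℤ) : ∀ᶠ σ' in 𝓝 σ, σ'.1 k = σ.1 k := by
  have h : Continuous fun σ : Subshift R => σ.1 k := (continuous_apply k).comp continuous_subtype_val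
  exact h.continuousAt.eventually ((isOpen_discrete {σ.1 k}).mem_nhds rfl)

theorem compactSpace [Finite A] : CompactSpace (Subshift R) := by
  refine isCompact_iff_compactSpace.1 (IsClosed.isCompact ?_)
  change IsClosed {σ : ℤ → A | ∀ k, R (σ k) (σ (k + 1))}
  rw [ofPred_forall]
  refine isClosed_iInter fun k => ?_
  have h : Continuous fun σ : ℤ → A => (σ k, σ (k + 1)) := by fun_prop
  exact (isClosed_discrete {p : A × A | R p.1 p.2}).preimage h

end Subshift

/-! ### Geodesic lines coded by sequences of letters -/

/-- A letter: a signed generator, i.e. a direction in the tree, and the number of a copy of the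
corresponding edge. -/
abbrev Letter (ℓ : ℕ) : Type := (Fin ℓ × Bool) × Bool

namespace Letter

variable {ℓ : ℕ}

/-- The letter `b` may follow `a` if the path does not go back along an edge of the tree. -/
def Follows (a b : Letter ℓ) : Prop := a.1.1 = b.1.1 → a.1.2 = b.1.2

/-- The element of the free group underlying a letter. -/
def elt (a : Letter ℓ) : FreeGroup (Fin ℓ) := FreeGroup.mk [a.1]

theorem elt_eq (a : Letter ℓ) :
    a.elt = if a.1.2 then FreeGroup.of a.1.1 else (FreeGroup.of a.1.1)⁻¹ := by
  obtain ⟨⟨i, d⟩, c⟩ := a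
  cases d <;> rfl

theorem elt_mul_elt_of_not_follows {a b : Letter ℓ} (h : ¬ Follows a b) : a.elt * b.elt = 1 := by
  obtain ⟨⟨i, d⟩, c⟩ := a
  obtain ⟨⟨j, d'⟩, c'⟩ := b
  simp only [Follows, not_forall] at h
  obtain ⟨rfl, h⟩ := h
  rw [elt_eq, elt_eq]
  cases d <;> cases d' <;> simp_all

theorem card_follows (a : Letter ℓ) : Nat.card {b : Letter ℓ // Follows a b} = (2 * ℓ - 1) * 2 := by
  have e : {b : Letter ℓ // Follows a b} ≃
      {b : Fin ℓ × Bool // a.1.1 = b.1 → a.1.2 = b.2} × Bool :=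
    Equiv.prodSubtypeFstEquivSubtypeProd (p := fun b : Fin ℓ × Bool => a.1.1 = b.1 → a.1.2 = b.2)
  rw [Nat.card_congr e, Nat.card_prod, card_successors]
  simp

/-- The point at distance `t` from the vertex `v` on the edge issuing from `v` described by the
letter `a`. (Times outside of `[0, 1]` are projected to this interval.) -/
def along (v : FreeGroup (Fin ℓ)) (a : Letter ℓ) (t : ℝ) : EdgePoint ℓ :=
  if a.1.2 then ⟨v, a.1.1, a.2, projIcc 0 1 zero_le_one t⟩
  else ⟨v * (FreeGroup.of a.1.1)⁻¹, a.1.1, a.2, projIcc 0 1 zero_le_one (1 - t)⟩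

theorem endpt_along_start (v : FreeGroup (Fin ℓ)) (a : Letter ℓ) (t : ℝ) :
    (along v a t).endpt (!a.1.2) = v := by
  obtain ⟨⟨i, d⟩, c⟩ := a
  cases d <;> simp [along, endpt]

theorem endpt_along_end (v : FreeGroup (Fin ℓ)) (a : Letter ℓ) (t : ℝ) :
    (along v a t).endpt a.1.2 = v * a.elt := by
  rw [elt_eq]
  obtain ⟨⟨i, d⟩, c⟩ := a
  cases d <;> simp [along, endpt]

theorem arm_along_start (v : FreeGroup (Fin ℓ)) (a : Letter ℓ) {t : ℝ} (ht : t ∈ Icc (0 : ℝ) 1) :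
    (along v a t).arm (!a.1.2) = t := by
  have ht' : 1 - t ∈ Icc (0 : ℝ) 1 := ⟨by linarith [ht.2], by linarith [ht.1]⟩
  obtain ⟨⟨i, d⟩, c⟩ := a
  cases d <;> simp [along, arm, projIcc_of_mem _ ht, projIcc_of_mem _ ht']

theorem arm_along_end (v : FreeGroup (Fin ℓ)) (a : Letter ℓ) {t : ℝ} (ht : t ∈ Icc (0 : ℝ) 1) :
    (along v a t).arm a.1.2 = 1 - t := by
  have h1 := arm_along_start v a ht
  have h2 := DoubledTree.arm_add_arm_not (along v a t) a.1.2
  linarith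

theorem smul_along (g v : FreeGroup (Fin ℓ)) (a : Letter ℓ) (t : ℝ) :
    g • along v a t = along (g * v) a t := by
  obtain ⟨⟨i, d⟩, c⟩ := a
  cases d
  · change EdgePoint.mk (g * (v * _)) _ _ _ = EdgePoint.mk (g * v * _) _ _ _
    rw [mul_assoc]
    rfl
  · rfl

theorem sameEdge_along (v : FreeGroup (Fin ℓ)) (a : Letter ℓ) (t t' : ℝ) :
    SameEdge (along v a t) (along v a t') := by
  obtain ⟨⟨i, d⟩, c⟩ := a
  cases d <;> exact ⟨rfl, rfl, rfl⟩

theorem eq_of_sameEdge_along {v : FreeGroup (Fin ℓ)} {a b : Letter ℓ} {t t' : ℝ}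
    (h : SameEdge (along v a t) (along v b t')) : a = b := by
  obtain ⟨⟨i, d⟩, c⟩ := a
  obtain ⟨⟨j, d'⟩, c'⟩ := b
  cases d <;> cases d' <;> simp_all [SameEdge, along]

theorem dist_along (v : FreeGroup (Fin ℓ)) (a : Letter ℓ) {t t' : ℝ} (ht : t ∈ Icc (0 : ℝ) 1)
    (ht' : t' ∈ Icc (0 : ℝ) 1) :
    dist (DoubledTree.pt (along v a t)) (DoubledTree.pt (along v a t')) = |t - t'| := by
  rw [DoubledTree.dist_pt, dist_of_same (sameEdge_along v a t t')]
  have h1 := arm_along_start v a ht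
  have h2 := arm_along_start v a ht'
  obtain ⟨⟨i, d⟩, c⟩ := a
  cases d
  · simp only [arm, Bool.not_false, if_true] at h1 h2
    have e : t - t' = -(((along v ((i, false), c) t).pos : ℝ) -
        (along v ((i, false), c) t').pos) := by linarith
    rw [e, abs_neg]
  · simp only [arm, Bool.not_true, Bool.false_eq_true, if_false] at h1 h2
    rw [h1, h2]

/-- A path between different edges issuing from `v` runs through `v` or through the other end of both
edges (which may coincide, for two copies of one edge) or is longer than the one through `v`. -/
theorem le_dist_along {v : FreeGroup (Fin ℓ)} {a b : Letter ℓ} (hab : a ≠ b) {t t' : ℝ}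
    (ht : t ∈ Icc (0 : ℝ) 1) (ht' : t' ∈ Icc (0 : ℝ) 1) :
    min (t + t') (2 - t - t') ≤ dist (DoubledTree.pt (along v a t)) (DoubledTree.pt (along v b t')) := by
  rcases DoubledTree.sameEdge_or_exists_dist_pt (along v a t) (along v b t') with h | ⟨c, c', h⟩
  · exact absurd (eq_of_sameEdge_along h) hab
  · have ha : ∀ a : Letter ℓ, vdist v (v * a.elt) = 1 := fun a => by
      have := DoubledTree.vdist_endpt_not (along v a 0) (!a.1.2)
      rwa [Bool.not_not, endpt_along_start, endpt_along_end] at this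
    have hn := vdist_nonneg ((along v a t).endpt c) ((along v b t').endpt c')
    rcases Bool.eq_or_eq_not c a.1.2 with rfl | rfl <;>
      rcases Bool.eq_or_eq_not c' b.1.2 with rfl | rfl <;>
      simp only [arm_along_end _ _ ht, arm_along_start _ _ ht, arm_along_end _ _ ht',
        arm_along_start _ _ ht', endpt_along_start, endpt_along_end] at h hn
    · exact min_le_of_right_le (by linarith)
    · rw [vdist_comm, ha] at h
      exact min_le_of_left_le (by linarith [ht.2])
    · rw [ha] at h
      exact min_le_of_left_le (by linarith [ht'.2])
    · exact min_le_of_left_le (by linarith)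

/-- A point of an edge lies along this edge, as seen from either of its endpoints. -/
theorem eq_along (q : EdgePoint ℓ) (c : Bool) :
    q = along (q.endpt c) ((q.gen, !c), q.copy) (q.arm c) := by
  obtain ⟨b, i, e, s⟩ := q
  cases c <;> simp [along, endpt, arm]

variable [NeZero ℓ]

theorem pt_along_zero (v : FreeGroup (Fin ℓ)) (a : Letter ℓ) :
    DoubledTree.pt (along v a 0) = DoubledTree.vert v := by
  rw [DoubledTree.pt_eq_vert (arm_along_start v a ⟨le_rfl, zero_le_one⟩), endpt_along_start]

theorem pt_along_one (v : FreeGroup (Fin ℓ)) (a : Letter ℓ) :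
    DoubledTree.pt (along v a 1) = DoubledTree.vert (v * a.elt) := by
  rw [DoubledTree.pt_eq_vert (c := a.1.2), endpt_along_end]
  rw [arm_along_end v a ⟨zero_le_one, le_rfl⟩, sub_self]

end Letter

namespace DoubledTree

variable {ℓ : ℕ}

/-- The vertices reached by reading the letters of nonnegative index. -/
def vtxPos (s : ℤ → Letter ℓ) : ℕ → FreeGroup (Fin ℓ)
  | 0 => 1
  | n + 1 => vtxPos s n * (s n).elt

/-- The vertices reached by reading the letters of negative index backwards. -/
def vtxNeg (s : ℤ → Letter ℓ) : ℕ → FreeGroup (Fin ℓ)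
  | 0 => 1
  | n + 1 => vtxNeg s n * (s (Int.negSucc n)).elt⁻¹

/-- The vertices of the path which reads the letters `s k` and is at the vertex `1` at time `0`. -/
def vtx (s : ℤ → Letter ℓ) : ℤ → FreeGroup (Fin ℓ)
  | Int.ofNat n => vtxPos s n
  | Int.negSucc n => vtxNeg s (n + 1)

theorem vtx_zero (s : ℤ → Letter ℓ) : vtx s 0 = 1 := rfl

theorem vtx_succ (s : ℤ → Letter ℓ) (k : ℤ) : vtx s (k + 1) = vtx s k * (s k).elt := by
  rcases k with n | n
  · rfl
  · rcases n with _ | n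
    · simp [vtx, vtxNeg, vtxPos]
    · change vtxNeg s (n + 1) = vtxNeg s (n + 1) * (s (Int.negSucc (n + 1))).elt⁻¹ * _
      rw [inv_mul_cancel_right]

/-- Paths reading the same letters differ by a left translation. -/
theorem eq_mul_vtx {s : ℤ → Letter ℓ} {w : ℤ → FreeGroup (Fin ℓ)}
    (hw : ∀ k, w (k + 1) = w k * (s k).elt) (k : ℤ) : w k = w 0 * vtx s k := by
  induction k using Int.induction_on with
  | zero => simp [vtx_zero]
  | succ n ih => rw [hw, ih, vtx_succ, mul_assoc]
  | pred n ih =>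
    have h1 := hw (-n - 1)
    have h2 := vtx_succ s (-n - 1)
    rw [sub_add_cancel] at h1 h2
    rw [h1, h2, ← mul_assoc] at ih
    exact mul_right_cancel ih

theorem inv_vtx_mul_vtx (s : ℤ → Letter ℓ) (m : ℤ) (n : ℕ) :
    (vtx s m)⁻¹ * vtx s (m + n) = FreeGroup.mk ((List.range n).map fun j : ℕ => (s (m + j)).1) := by
  induction n with
  | zero => simp; rfl
  | succ n ih =>
    rw [List.range_succ, List.map_append, ← FreeGroup.mul_mk, ← ih, Nat.cast_succ, ← add_assoc,
      vtx_succ, mul_assoc]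
    rfl

theorem vdist_vtx (σ : Subshift (Letter.Follows (ℓ := ℓ))) (m : ℤ) (n : ℕ) :
    vdist (vtx σ.1 m) (vtx σ.1 (m + n)) = n := by
  have h : FreeGroup.IsReduced ((List.range n).map fun j : ℕ => (σ.1 (m + j)).1) :=
    isChain_map_range (s := fun j : ℕ => (σ.1 (m + j)).1) (fun k => by
      have := σ.2 (m + k)
      rw [add_assoc] at this
      exact_mod_cast this) n
  rw [vdist, inv_vtx_mul_vtx, norm_mk_of_isReduced h, List.length_map, List.length_range]

theorem eventually_vtx_eq (σ : Subshift (Letter.Follows (ℓ := ℓ))) (k : ℤ) :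
    ∀ᶠ σ' in 𝓝 σ, vtx σ'.1 k = vtx σ.1 k := by
  have h1 : ∀ n, ∀ᶠ σ' in 𝓝 σ, vtxPos σ'.1 n = vtxPos σ.1 n := by
    intro n
    induction n with
    | zero => exact Eventually.of_forall fun _ => rfl
    | succ n ih =>
      filter_upwards [ih, σ.eventually_eq n] with σ' h h'
      rw [vtxPos, vtxPos, h, h']
  have h2 : ∀ n, ∀ᶠ σ' in 𝓝 σ, vtxNeg σ'.1 n = vtxNeg σ.1 n := by
    intro n
    induction n with
    | zero => exact Eventually.of_forall fun _ => rfl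
    | succ n ih =>
      filter_upwards [ih, σ.eventually_eq (Int.negSucc n)] with σ' h h'
      rw [vtxNeg, vtxNeg, h, h']
  rcases k with n | n
  · exact h1 n
  · exact h2 (n + 1)

/-- The path with unit speed which follows the edges `s k`, and is at the vertex `1` at time
`0`. -/
def path (s : ℤ → Letter ℓ) (t : ℝ) : DoubledTree ℓ :=
  pt (Letter.along (vtx s ⌊t⌋) (s ⌊t⌋) (Int.fract t))

/-- After one step, the path is a translate of the path coded by the shifted sequence. -/
theorem path_add_one (σ : Subshift (Letter.Follows (ℓ := ℓ))) (t : ℝ) :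
    path σ.1 (t + 1) = action ℓ (vtx σ.1 1) (path σ.shift.1 t) := by
  have h := eq_mul_vtx (s := σ.shift.1) (w := fun k => vtx σ.1 (k + 1))
    (fun k => vtx_succ σ.1 (k + 1)) ⌊t⌋
  rw [path, path, action_pt, Letter.smul_along, Int.floor_add_one, Int.fract_add_one]
  congr 2

variable [NeZero ℓ]

theorem path_intCast (s : ℤ → Letter ℓ) (k : ℤ) : path s k = vert (vtx s k) := by
  rw [path, Int.floor_intCast, Int.fract_intCast, Letter.pt_along_zero]

theorem path_add (s : ℤ → Letter ℓ) (k : ℤ) {t : ℝ} (ht : t ∈ Icc (0 : ℝ) 1) :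
    path s (k + t) = pt (Letter.along (vtx s k) (s k) t) := by
  rcases eq_or_lt_of_le ht.2 with rfl | h
  · rw [Letter.pt_along_one, ← vtx_succ, ← path_intCast]
    push_cast
    rfl
  · have h0 : ⌊t⌋ = 0 := Int.floor_eq_zero_iff.2 ⟨ht.1, h⟩
    rw [path, Int.floor_intCast_add, h0, add_zero, Int.fract_intCast_add, Int.fract, h0,
      Int.cast_zero, sub_zero]

theorem dist_path_floor (s : ℤ → Letter ℓ) (t : ℝ) :
    dist (vert (vtx s ⌊t⌋)) (path s t) = Int.fract t := by
  have h := Letter.dist_along (vtx s ⌊t⌋) (s ⌊t⌋) (t := 0) (t' := Int.fract t) ⟨le_rfl, zero_le_one⟩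
    ⟨Int.fract_nonneg t, (Int.fract_lt_one t).le⟩
  rw [Letter.pt_along_zero, zero_sub, abs_neg, abs_of_nonneg (Int.fract_nonneg t)] at h
  exact h

theorem dist_path_floor_add_one (s : ℤ → Letter ℓ) (t : ℝ) :
    dist (path s t) (vert (vtx s (⌊t⌋ + 1))) = 1 - Int.fract t := by
  have h := Letter.dist_along (vtx s ⌊t⌋) (s ⌊t⌋) (t := Int.fract t) (t' := 1)
    ⟨Int.fract_nonneg t, (Int.fract_lt_one t).le⟩ ⟨zero_le_one, le_rfl⟩
  rw [Letter.pt_along_one, abs_sub_comm, ← vtx_succ,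
    abs_of_nonneg (sub_nonneg.2 (Int.fract_lt_one t).le)] at h
  exact h

/-- The path coded by a sequence without backtracking is a geodesic line: it has speed at most `1`,
and the distance between the vertices at times `m ≤ n` is the length `n - m` of a reduced word. -/
theorem isometry_path (σ : Subshift (Letter.Follows (ℓ := ℓ))) : Isometry (path σ.1) := by
  have key : ∀ t t' : ℝ, t ≤ t' → dist (path σ.1 t) (path σ.1 t') = t' - t := by
    intro t t' h
    have hfl := Int.floor_le_floor h
    have e1 := Int.floor_add_fract t
    have e2 := Int.floor_add_fract t'
    apply le_antisymm
    · rcases eq_or_lt_of_le hfl with hf | hf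
      · have := Letter.dist_along (vtx σ.1 ⌊t⌋) (σ.1 ⌊t⌋)
          ⟨Int.fract_nonneg t, (Int.fract_lt_one t).le⟩
          ⟨Int.fract_nonneg t', (Int.fract_lt_one t').le⟩
        rw [path, path, ← hf, this]
        have e3 : (⌊t⌋ : ℝ) = ⌊t'⌋ := by rw [hf]
        rw [abs_le]
        constructor <;> linarith
      · obtain ⟨n, hn⟩ := Int.le.dest hf
        have h1 := vdist_vtx σ (⌊t⌋ + 1) n
        rw [hn, ← dist_vert] at h1
        have h2 := dist_triangle4 (path σ.1 t) (vert (vtx σ.1 (⌊t⌋ + 1))) (vert (vtx σ.1 ⌊t'⌋))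
          (path σ.1 t')
        rw [dist_path_floor_add_one, dist_path_floor, h1] at h2
        have e3 : (⌊t⌋ : ℝ) + 1 + n = ⌊t'⌋ := by exact_mod_cast hn
        linarith
    · obtain ⟨n, hn⟩ := Int.le.dest (hfl.trans (by omega : ⌊t'⌋ ≤ ⌊t'⌋ + 1))
      have h1 := vdist_vtx σ ⌊t⌋ n
      rw [hn, ← dist_vert] at h1
      have h2 := dist_triangle4 (vert (vtx σ.1 ⌊t⌋)) (path σ.1 t) (path σ.1 t')
        (vert (vtx σ.1 (⌊t'⌋ + 1)))
      rw [dist_path_floor_add_one, dist_path_floor, h1] at h2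
      have e3 : (⌊t⌋ : ℝ) + n = ⌊t'⌋ + 1 := by exact_mod_cast hn
      linarith
  refine Isometry.of_dist_eq fun t t' => ?_
  rw [Real.dist_eq]
  rcases le_total t t' with h | h
  · rw [key t t' h, abs_sub_comm, abs_of_nonneg (sub_nonneg.2 h)]
  · rw [dist_comm, key t' t h, abs_of_nonneg (sub_nonneg.2 h)]

/-- The geodesic line coded by a sequence of letters. -/
def line (σ : Subshift (Letter.Follows (ℓ := ℓ))) : Geod (DoubledTree ℓ) :=
  ⟨⟨path σ.1, (isometry_path σ).continuous⟩, isometry_path σ⟩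

theorem continuous_path : Continuous fun p : Subshift (Letter.Follows (ℓ := ℓ)) × ℝ =>
    path p.1.1 p.2 := by
  refine continuous_prod_of_continuous_lipschitzWith' _ 1 (fun σ => (isometry_path σ).lipschitz)
    fun t => ?_
  refine continuous_iff_continuousAt.2 fun σ => ?_
  refine (continuousAt_const (y := path σ.1 t)).congr ?_
  filter_upwards [eventually_vtx_eq σ ⌊t⌋, σ.eventually_eq ⌊t⌋] with σ' h h'
  rw [path, path, h, h']

theorem continuous_flow_line : Continuous fun p : Subshift (Letter.Follows (ℓ := ℓ)) × Icc (0 : ℝ) 1 =>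
    Geod.flow (p.2 : ℝ) (line p.1) := by
  refine Continuous.subtype_mk (ContinuousMap.continuous_of_continuous_uncurry _ ?_) _
  exact continuous_path.comp (f := fun q : (Subshift (Letter.Follows (ℓ := ℓ)) × Icc (0 : ℝ) 1) × ℝ =>
    (q.1.1, q.2 + (q.1.2 : ℝ))) (by fun_prop)

/-! ### Failure of line-convexity -/

theorem not_isLineConvex : ¬ IsLineConvex (DoubledTree ℓ) := by
  intro h
  -- Two lines along the same axis, which use different copies of the edge at `[0, 1]` only.
  let s : Bool → Subshift (Letter.Follows (ℓ := ℓ)) := fun c =>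
    ⟨fun k => ((0, true), if k = 0 then c else false), fun _ _ => rfl⟩
  have hv : ∀ c, vtx (s c).1 1 = FreeGroup.of 0 := fun c => by
    have := vtx_succ (s c).1 0
    rw [vtx_zero, one_mul] at this
    exact this
  have h0 : ∀ c, path (s c).1 0 = vert 1 := fun c => by
    have := path_intCast (s c).1 0
    rwa [Int.cast_zero, vtx_zero] at this
  have h1 : ∀ c, path (s c).1 1 = vert (FreeGroup.of 0) := fun c => by
    have := path_intCast (s c).1 1
    rwa [Int.cast_one, hv] at this
  have h2 : ∀ c, path (s c).1 (1 / 2) = pt (Letter.along 1 ((0, true), c) (1 / 2)) := fun c => by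
    have := path_add (s c).1 0 (t := 1 / 2) ⟨by norm_num, by norm_num⟩
    rwa [Int.cast_zero, zero_add] at this
  have hc := (h _ _ (isometry_path (s false)) (isometry_path (s true))).2 (mem_univ 0) (mem_univ 1)
    (by norm_num : (0 : ℝ) ≤ 1 / 2) (by norm_num : (0 : ℝ) ≤ 1 / 2) (by norm_num)
  have hd := Letter.le_dist_along (v := (1 : FreeGroup (Fin ℓ))) (a := ((0, true), false))
    (b := ((0, true), true)) (by simp) (t := 1 / 2) (t' := 1 / 2) ⟨by norm_num, by norm_num⟩
    ⟨by norm_num, by norm_num⟩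
  rw [smul_zero, zero_add, smul_eq_mul, mul_one] at hc
  simp only [h0, h1, h2, dist_self, smul_zero, add_zero] at hc
  norm_num at hd
  linarith

/-! ### Every geodesic line is coded by a sequence of letters -/

/-- A geodesic line meets the set of vertices. -/
theorem exists_eq_vert {γ : ℝ → DoubledTree ℓ} (hγ : Isometry γ) : ∃ t v, γ t = vert v := by
  obtain ⟨p, hp⟩ := SeparationQuotient.surjective_mk (γ 0)
  -- Moving by the distance `m` from `γ 0` to the nearest vertex, in one of the two directions,
  -- leads to a vertex.
  obtain ⟨c₀, hc₀⟩ : ∃ c₀, ∀ c, p.arm c₀ ≤ p.arm c := by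
    rcases le_total (p.arm false) (p.arm true) with h | h
    · exact ⟨false, Bool.forall_bool.2 ⟨le_rfl, h⟩⟩
    · exact ⟨true, Bool.forall_bool.2 ⟨h, le_rfl⟩⟩
  set m := p.arm c₀ with hm
  have hm0 : 0 ≤ m := arm_nonneg p c₀
  have key : ∀ t, |t| = m → (∃ v, γ t = vert v) ∨
      ∃ q : EdgePoint ℓ, γ t = pt q ∧ SameEdge p q ∧ |(p.pos : ℝ) - q.pos| = m := by
    intro t ht
    obtain ⟨q, hq⟩ := SeparationQuotient.surjective_mk (γ t)
    have hd : dist (pt p) (pt q) = m := by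
      rw [pt, pt, hp, hq, hγ.dist_eq, Real.dist_eq, zero_sub, abs_neg, ht]
    rcases sameEdge_or_exists_dist_pt p q with h | ⟨c, c', h⟩
    · exact Or.inr ⟨q, hq.symm, h, by rw [← hd, dist_pt, dist_of_same h]⟩
    · left
      have h1 := hc₀ c
      have h2 := arm_nonneg q c'
      have h3 := vdist_nonneg (p.endpt c) (q.endpt c')
      exact ⟨_, hq.symm.trans (pt_eq_vert (c := c') (by linarith))⟩
  rcases key m (abs_of_nonneg hm0) with ⟨v, h⟩ | ⟨q, hq, hs, ha⟩
  · exact ⟨_, v, h⟩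
  rcases key (-m) (by rw [abs_neg, abs_of_nonneg hm0]) with ⟨v, h⟩ | ⟨q', hq', hs', ha'⟩
  · exact ⟨_, v, h⟩
  have hd : |(q.pos : ℝ) - q'.pos| = m + m := by
    rw [← dist_of_same (hs.symm.trans hs'), ← dist_pt, ← hq, ← hq', hγ.dist_eq, Real.dist_eq,
      sub_neg_eq_add, abs_of_nonneg (by linarith)]
  have h0 : q.arm c₀ = 0 ∨ q'.arm c₀ = 0 := by
    rcases abs_eq hm0 |>.1 ha with ha | ha <;> rcases abs_eq hm0 |>.1 ha' with ha' | ha' <;>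
      rcases abs_eq (by linarith : (0 : ℝ) ≤ m + m) |>.1 hd with hd | hd <;>
      cases c₀ <;> simp only [arm, if_true, Bool.false_eq_true, if_false] at hm ⊢ <;>
      first
        | (left; linarith)
        | (right; linarith)
  rcases h0 with h0 | h0
  · exact ⟨_, _, hq.trans (pt_eq_vert h0)⟩
  · exact ⟨_, _, hq'.trans (pt_eq_vert h0)⟩

/-- A geodesic line leaves a vertex along one edge. -/
theorem exists_letter {γ : ℝ → DoubledTree ℓ} (hγ : Isometry γ) {v : FreeGroup (Fin ℓ)}
    (h0 : γ 0 = vert v) : ∃ a : Letter ℓ, ∀ t ∈ Icc (0 : ℝ) 1, γ t = pt (Letter.along v a t) := by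
  have key : ∀ t ∈ Ioo (0 : ℝ) 1, ∃ a : Letter ℓ, γ t = pt (Letter.along v a t) := by
    intro t ht
    obtain ⟨q, hq⟩ := SeparationQuotient.surjective_mk (γ t)
    have hd : dist (vert v) (pt q) = t := by
      rw [pt, hq, ← h0, hγ.dist_eq, Real.dist_eq, zero_sub, abs_neg, abs_of_pos ht.1]
    obtain ⟨c, hc⟩ := exists_dist_vert v q
    have hv : vdist v (q.endpt c) = 0 := by
      have h1 : vdist v (q.endpt c) < 1 := by linarith [arm_nonneg q c, ht.2]
      unfold vdist at h1 ⊢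
      have h2 : (v⁻¹ * q.endpt c).norm < 1 := by exact_mod_cast h1
      rw [Nat.lt_one_iff.1 h2, Nat.cast_zero]
    have ha : q.arm c = t := by linarith
    refine ⟨((q.gen, !c), q.copy), ?_⟩
    rw [← hq, vdist_eq_zero.1 hv, ← ha, ← Letter.eq_along]
  obtain ⟨a, ha⟩ := key (1 / 2) ⟨by norm_num, by norm_num⟩
  -- The edge is the one containing `γ (1 / 2)`: a point on another edge would be too far from it.
  have key' : ∀ t ∈ Ioo (0 : ℝ) 1, γ t = pt (Letter.along v a t) := by
    intro t ht
    obtain ⟨b, hb⟩ := key t ht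
    by_cases hab : b = a
    · rw [hb, hab]
    · have h1 := Letter.le_dist_along (v := v) hab ⟨ht.1.le, ht.2.le⟩
        (⟨by norm_num, by norm_num⟩ : (1 / 2 : ℝ) ∈ Icc (0 : ℝ) 1)
      rw [← ha, ← hb, hγ.dist_eq, Real.dist_eq] at h1
      exfalso
      have h2 := ht.1
      have h3 := ht.2
      rcases min_le_iff.1 h1 with h1 | h1 <;> rcases le_abs.1 h1 with h1 | h1 <;> linarith
  refine ⟨a, fun t ht => ?_⟩
  rcases eq_or_lt_of_le ht.1 with rfl | h
  · rw [h0, Letter.pt_along_zero]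
  rcases eq_or_lt_of_le ht.2 with rfl | h'
  · refine dist_le_zero.1 (le_of_forall_pos_le_add fun ε hε => ?_)
    set δ := min (ε / 2) (1 / 2)
    have hδ : 0 < δ := by positivity
    have hδ1 : δ ≤ 1 / 2 := min_le_right _ _
    have hδ2 : δ ≤ ε / 2 := min_le_left _ _
    have e := key' (1 - δ) ⟨by linarith, by linarith⟩
    have h1 := dist_triangle (γ 1) (γ (1 - δ)) (pt (Letter.along v a 1))
    rw [hγ.dist_eq, e, Letter.dist_along v a ⟨by linarith, by linarith⟩ ht, Real.dist_eq] at h1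
    have e1 : |1 - (1 - δ)| = δ := by rw [sub_sub_cancel, abs_of_pos hδ]
    have e2 : |1 - δ - 1| = δ := by rw [abs_sub_comm, e1]
    rw [e1, e2] at h1
    linarith
  · exact key' t ⟨h, h'⟩

/-- The set of times at which a geodesic line is at a vertex is invariant under integral
translations. -/
theorem exists_vert_add_intCast {γ : ℝ → DoubledTree ℓ} (hγ : Isometry γ) {t : ℝ}
    (ht : ∃ v, γ t = vert v) (k : ℤ) : ∃ v, γ (t + k) = vert v := by
  have key : ∀ γ : ℝ → DoubledTree ℓ, Isometry γ → ∀ t : ℝ, (∃ v, γ t = vert v) →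
      ∃ v, γ (t + 1) = vert v := by
    rintro γ hγ t ⟨v, hv⟩
    have hi : Isometry fun u => γ (t + u) := hγ.comp (Isometry.of_dist_eq fun a b => dist_add_left t a b)
    obtain ⟨a, ha⟩ := exists_letter hi (v := v) (by simpa using hv)
    exact ⟨_, (ha 1 ⟨zero_le_one, le_rfl⟩).trans (Letter.pt_along_one v a)⟩
  induction k using Int.induction_on with
  | zero => simpa using ht
  | succ n ih =>
    have := key γ hγ _ ih
    push_cast
    rwa [add_assoc] at this
  | pred n ih =>
    have := key (fun u => γ (-u)) (hγ.comp (Isometry.of_dist_eq fun a b => dist_neg_neg a b))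
      (-(t + ((-(n : ℤ) : ℤ) : ℝ))) (by simpa using ih)
    have e : -(-(t + ((-(n : ℤ) : ℤ) : ℝ)) + 1) = t + ((-(n : ℤ) - 1 : ℤ) : ℝ) := by
      push_cast
      ring
    rwa [e] at this

/-- Up to the free group and a time in `[0, 1]`, every geodesic line is coded by a sequence. -/
theorem exists_line_eq {γ : ℝ → DoubledTree ℓ} (hγ : Isometry γ) :
    ∃ (σ : Subshift (Letter.Follows (ℓ := ℓ))) (τ : Icc (0 : ℝ) 1) (g : FreeGroup (Fin ℓ)),
      ∀ t, γ t = action ℓ g (path σ.1 (t + τ)) := by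
  obtain ⟨t₀, ht₀⟩ := exists_eq_vert hγ
  -- Up to an integral translation, the time at a vertex is `-τ` with `τ ∈ [0, 1]`.
  let τ : Icc (0 : ℝ) 1 := ⟨Int.fract (-t₀), Int.fract_nonneg _, (Int.fract_lt_one _).le⟩
  have hτ : ∀ k : ℤ, ∃ v, γ (-(τ : ℝ) + k) = vert v := fun k => by
    refine exists_vert_add_intCast hγ ?_ k
    have h := exists_vert_add_intCast hγ ht₀ ⌊-t₀⌋
    have e : t₀ + (⌊-t₀⌋ : ℝ) = -(τ : ℝ) := by
      have := Int.floor_add_fract (-t₀)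
      change _ = -Int.fract (-t₀)
      linarith
    rwa [e] at h
  choose v hv using hτ
  have hi : ∀ k : ℤ, Isometry fun u => γ (-(τ : ℝ) + k + u) := fun k =>
    hγ.comp (Isometry.of_dist_eq fun a b => dist_add_left _ a b)
  choose s hs using fun k : ℤ => exists_letter (hi k) (v := v k) (by simpa using hv k)
  have hstep : ∀ k, v (k + 1) = v k * (s k).elt := fun k => by
    have h := hs k 1 ⟨zero_le_one, le_rfl⟩
    rw [Letter.pt_along_one] at h
    refine vert_injective ?_
    rw [← h, ← hv]
    push_cast
    rw [add_assoc]
  have hfol : ∀ k, Letter.Follows (s k) (s (k + 1)) := fun k => by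
    by_contra hn
    have h1 : v (k + 1 + 1) = v k := by
      rw [hstep, hstep, mul_assoc, Letter.elt_mul_elt_of_not_follows hn, mul_one]
    have h2 : dist (γ (-(τ : ℝ) + (k + 1 + 1 : ℤ))) (γ (-(τ : ℝ) + k)) = 0 := by
      rw [hv, hv, h1, dist_self]
    rw [hγ.dist_eq, Real.dist_eq] at h2
    push_cast at h2
    rw [abs_eq_zero] at h2
    linarith
  refine ⟨⟨s, hfol⟩, τ, v 0, fun t => ?_⟩
  have h := hs ⌊t + τ⌋ (Int.fract (t + τ)) ⟨Int.fract_nonneg _, (Int.fract_lt_one _).le⟩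
  have e : -(τ : ℝ) + ⌊t + τ⌋ + Int.fract (t + τ) = t := by
    have := Int.floor_add_fract (t + (τ : ℝ))
    linarith
  simp only [e] at h
  rw [h, path, action_pt, Letter.smul_along, ← eq_mul_vtx hstep]

/-! ### The coding of the quotient geodesic flow -/

/-- The geodesic line coded by a sequence, after the time `τ`, modulo the free group. -/
def coding (p : Subshift (Letter.Follows (ℓ := ℓ)) × Icc (0 : ℝ) 1) : GeodQuot (freeIsomGroup ℓ) :=
  Quotient.mk _ (Geod.flow (p.2 : ℝ) (line p.1))

theorem continuous_coding : Continuous (coding (ℓ := ℓ)) :=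
  continuous_quotient_mk'.comp continuous_flow_line

theorem coding_surjective : Function.Surjective (coding (ℓ := ℓ)) := by
  intro y
  obtain ⟨γ, rfl⟩ := Quotient.exists_rep y
  obtain ⟨σ, τ, g, h⟩ := exists_line_eq γ.2
  exact ⟨(σ, τ), Quotient.sound ⟨action ℓ g, ⟨g, rfl⟩, h⟩⟩

theorem quotFlow_coding (σ : Subshift (Letter.Follows (ℓ := ℓ))) (τ : Icc (0 : ℝ) 1) :
    quotFlow (freeIsomGroup ℓ) 1 (coding (σ, τ)) = coding (σ.shift, τ) := by
  refine Quotient.sound (Setoid.symm' _ ⟨action ℓ (vtx σ.1 1), ⟨_, rfl⟩, fun t => ?_⟩)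
  change path σ.1 (t + 1 + τ) = action ℓ (vtx σ.1 1) (path σ.shift.1 (t + τ))
  rw [← path_add_one, add_right_comm]

/-- A line starting at a vertex determines the letter of its first edge, even modulo the free
group. -/
theorem apply_zero_eq_of_coding_eq {σ σ' : Subshift (Letter.Follows (ℓ := ℓ))}
    (h : coding (σ, 0) = coding (σ', 0)) : σ.1 0 = σ'.1 0 := by
  obtain ⟨_, ⟨g, rfl⟩, h⟩ := Quotient.exact h
  have h' : ∀ t, path σ'.1 t = action ℓ g (path σ.1 t) := fun t => by
    have := h t
    change path σ'.1 (t + (0 : ℝ)) = action ℓ g (path σ.1 (t + (0 : ℝ))) at this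
    rwa [add_zero] at this
  have hp : ∀ σ : Subshift (Letter.Follows (ℓ := ℓ)), ∀ t ∈ Icc (0 : ℝ) 1,
      path σ.1 t = pt (Letter.along 1 (σ.1 0) t) := fun σ t ht => by
    have := path_add σ.1 0 ht
    rwa [Int.cast_zero, zero_add, vtx_zero] at this
  have h0 := h' 0
  rw [hp _ 0 ⟨le_rfl, zero_le_one⟩, hp _ 0 ⟨le_rfl, zero_le_one⟩, action_pt, Letter.smul_along,
    Letter.pt_along_zero, Letter.pt_along_zero, mul_one] at h0
  have hg := vert_injective h0
  have hh : (1 / 2 : ℝ) ∈ Icc (0 : ℝ) 1 := ⟨by norm_num, by norm_num⟩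
  have h2 := h' (1 / 2)
  rw [hp _ _ hh, hp _ _ hh, action_pt, Letter.smul_along, ← hg, mul_one] at h2
  by_contra hne
  have h3 := Letter.le_dist_along (v := (1 : FreeGroup (Fin ℓ))) hne hh hh
  rw [h2, dist_self] at h3
  norm_num at h3

end DoubledTree

/-! ### Metrizability of the space of lines modulo a discrete group -/

section GeodQuotient

variable {X : Type*} [MetricSpace X]

/-- The action of an isometry on the space of geodesic lines. -/
def Geod.map (g : X ≃ᵢ X) (γ : Geod X) : Geod X :=
  ⟨⟨fun s => g (γ.1 s), g.continuous.comp γ.1.continuous⟩, g.isometry.comp γ.2⟩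

theorem Geod.continuous_map (g : X ≃ᵢ X) : Continuous (Geod.map g) :=
  ((ContinuousMap.continuous_postcomp (⟨g, g.continuous⟩ : C(X, X))).comp
    continuous_subtype_val).subtype_mk _

theorem Geod.continuous_apply (s : ℝ) : Continuous fun γ : Geod X => γ.1 s :=
  (continuous_eval_const s).comp continuous_subtype_val

theorem isOpenQuotientMap_geodQuot (Γ : Subgroup (X ≃ᵢ X)) :
    IsOpenQuotientMap (Quotient.mk (geodSetoid Γ)) := by
  refine ⟨Quotient.mk_surjective, continuous_quotient_mk', fun U hU => ?_⟩
  have h : Quotient.mk (geodSetoid Γ) ⁻¹' (Quotient.mk (geodSetoid Γ) '' U) =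
      ⋃ g ∈ Γ, Geod.map g ⁻¹' U := by
    ext γ
    simp only [mem_preimage, mem_image, mem_iUnion]
    constructor
    · rintro ⟨γ', hγ', h⟩
      obtain ⟨g, hg, h⟩ := Quotient.exact h.symm
      have e : Geod.map g γ = γ' := Subtype.ext (ContinuousMap.ext fun s => (h s).symm)
      exact ⟨g, hg, e ▸ hγ'⟩
    · rintro ⟨g, hg, h⟩
      exact ⟨_, h, (Quotient.sound ⟨g, hg, fun _ => rfl⟩ : Quotient.mk (geodSetoid Γ) γ = _).symm⟩
  rw [← isQuotientMap_quotient_mk'.isOpen_preimage]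
  change IsOpen (Quotient.mk (geodSetoid Γ) ⁻¹' (Quotient.mk (geodSetoid Γ) '' U))
  rw [h]
  exact isOpen_biUnion fun g _ => hU.preimage (Geod.continuous_map g)

/-- The orbit equivalence relation is closed, as a locally finite union of graphs. -/
theorem t2Space_geodQuot {Γ : Subgroup (X ≃ᵢ X)} (hΓ : IsDiscreteGroup Γ) :
    T2Space (GeodQuot Γ) := by
  rw [t2Space_iff_of_isOpenQuotientMap (isOpenQuotientMap_geodQuot Γ)]
  let F : Γ → Set (Geod X × Geod X) := fun g => {q | Geod.map g.1 q.1 = q.2}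
  have hF : {q : Geod X × Geod X | Quotient.mk (geodSetoid Γ) q.1 = Quotient.mk (geodSetoid Γ) q.2}
      = ⋃ g, F g := by
    ext q
    simp only [mem_ofPred_eq, mem_iUnion, F]
    constructor
    · intro h
      obtain ⟨g, hg, h⟩ := Quotient.exact h
      exact ⟨⟨g, hg⟩, Subtype.ext (ContinuousMap.ext fun s => (h s).symm)⟩
    · rintro ⟨g, h⟩
      refine Quotient.sound ⟨g.1, g.2, fun s => ?_⟩
      rw [← h]
      rfl
  rw [hF]
  refine LocallyFinite.isClosed_iUnion (fun q => ?_) fun g =>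
    isClosed_eq ((Geod.continuous_map g.1).comp continuous_fst) continuous_snd
  let V : Set (Geod X × Geod X) := {q' | dist (q'.1.1 0) (q.1.1 0) < 1 ∧ dist (q'.2.1 0) (q.2.1 0) < 1}
  have hV : V ∈ 𝓝 q := by
    have h1 : Continuous fun q' : Geod X × Geod X => dist (q'.1.1 0) (q.1.1 0) :=
      ((Geod.continuous_apply 0).comp continuous_fst).dist continuous_const
    have h2 : Continuous fun q' : Geod X × Geod X => dist (q'.2.1 0) (q.2.1 0) :=
      ((Geod.continuous_apply 0).comp continuous_snd).dist continuous_const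
    exact ((isOpen_lt h1 continuous_const).inter (isOpen_lt h2 continuous_const)).mem_nhds
      (by constructor <;> simp)
  refine ⟨V, hV, ?_⟩
  have hfin := hΓ (q.1.1 0) (2 + dist (q.2.1 0) (q.1.1 0))
  refine (hfin.preimage Subtype.val_injective.injOn).subset ?_
  rintro g ⟨q', hq', h1, h2⟩
  refine ⟨g.2, ?_⟩
  have h3 : g.1 (q'.1.1 0) = q'.2.1 0 := by
    rw [← show Geod.map g.1 q'.1 = q'.2 from hq']
    rfl
  have h4 := dist_triangle4 (g.1 (q.1.1 0)) (g.1 (q'.1.1 0)) (q.2.1 0) (q.1.1 0)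
  rw [g.1.dist_eq, dist_comm (q.1.1 0), h3] at h4
  rw [Metric.mem_closedBall]
  linarith

theorem secondCountableTopology_geodQuot [ProperSpace X] (Γ : Subgroup (X ≃ᵢ X)) :
    SecondCountableTopology (GeodQuot Γ) := by
  have : SecondCountableTopology (Geod X) :=
    IsEmbedding.subtypeVal.secondCountableTopology
  exact (isOpenQuotientMap_geodQuot Γ).isQuotientMap.secondCountableTopology
    (isOpenQuotientMap_geodQuot Γ).isOpenMap

end GeodQuotient

/-! ### Entropy of suspensions of subshifts -/

section Entropy

variable {A : Type*} {R : A → A → Prop} {Y : Type*} {T : Y → Y} {π : Subshift R × Icc (0 : ℝ) 1 → Y}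

theorem iterate_coding (hT : ∀ σ τ, T (π (σ, τ)) = π (σ.shift, τ)) (n : ℕ) (σ : Subshift R)
    (τ : Icc (0 : ℝ) 1) : T^[n] (π (σ, τ)) = π (Subshift.shift^[n] σ, τ) := by
  induction n generalizing σ with
  | zero => rfl
  | succ n ih => rw [Function.iterate_succ_apply, hT, ih, Function.iterate_succ_apply]

variable [TopologicalSpace A] [DiscreteTopology A] [Finite A]

/-- Uniform continuity: the points coded by sequences which agree on a long interval, at nearby
times, are close. -/
theorem exists_window [MetricSpace Y] (hπ : Continuous π) {r : ℝ} (hr : 0 < r) : ∃ N : ℕ,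
    ∀ p q : Subshift R × Icc (0 : ℝ) 1, (∀ k : ℤ, |k| ≤ N → p.1.1 k = q.1.1 k) →
      |(p.2 : ℝ) - q.2| ≤ 1 / ((N + 1 : ℕ) : ℝ) → dist (π p) (π q) ≤ r := by
  by_contra! hcon
  have : CompactSpace (Subshift R) := Subshift.compactSpace
  let P := Subshift R × Icc (0 : ℝ) 1
  let Z : ℕ → Set (P × P) := fun N => {x | (∀ k : ℤ, |k| ≤ N → x.1.1.1 k = x.2.1.1 k) ∧
    |(x.1.2 : ℝ) - x.2.2| ≤ 1 / ((N + 1 : ℕ) : ℝ) ∧ r ≤ dist (π x.1) (π x.2)}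
  have hZc : ∀ N, IsClosed (Z N) := by
    intro N
    have h1 : IsClosed {x : P × P | ∀ k : ℤ, |k| ≤ N → x.1.1.1 k = x.2.1.1 k} := by
      simp only [ofPred_forall]
      exact isClosed_iInter fun k => isClosed_iInter fun _ => isClosed_eq
        ((continuous_apply k).comp (continuous_subtype_val.comp (continuous_fst.comp continuous_fst)))
        ((continuous_apply k).comp (continuous_subtype_val.comp (continuous_fst.comp continuous_snd)))
    have h2 : IsClosed {x : P × P | |(x.1.2 : ℝ) - x.2.2| ≤ 1 / ((N + 1 : ℕ) : ℝ)} :=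
      isClosed_le (((continuous_subtype_val.comp (continuous_snd.comp continuous_fst)).sub
        (continuous_subtype_val.comp (continuous_snd.comp continuous_snd))).abs) continuous_const
    have h3 : IsClosed {x : P × P | r ≤ dist (π x.1) (π x.2)} :=
      isClosed_le continuous_const (by fun_prop)
    exact h1.inter (h2.inter h3)
  obtain ⟨x, hx⟩ := IsCompact.nonempty_iInter_of_sequence_nonempty_isCompact_isClosed Z
    (fun N x hx => ⟨fun k hk => hx.1 k (hk.trans (by push_cast; omega)),
      hx.2.1.trans (one_div_le_one_div_of_le (by positivity) (by push_cast; linarith)), hx.2.2⟩)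
    (fun N => by
      obtain ⟨p, q, h1, h2, h3⟩ := hcon N
      exact ⟨(p, q), h1, h2, h3.le⟩)
    (hZc 0).isCompact hZc
  rw [mem_iInter] at hx
  have e1 : x.1.1 = x.2.1 := Subtype.ext (funext fun k => (hx k.natAbs).1 k (by simp))
  have e2 : x.1.2 = x.2.2 := by
    refine Subtype.ext (sub_eq_zero.1 (abs_nonpos_iff.1 (le_of_forall_pos_le_add fun ε hε => ?_)))
    obtain ⟨N, hN⟩ := exists_nat_one_div_lt hε
    have := (hx N).2.1
    push_cast at this
    linarith
  have e : x.1 = x.2 := Prod.ext e1 e2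
  have := (hx 0).2.2
  rw [e, dist_self] at this
  linarith

variable {m : ℕ}

/-- Points are labelled by the words read in a window slightly larger than `[0, n)`. -/
theorem cov_dynDist_le [MetricSpace Y] (hR : ∀ a, Nat.card {b // R a b} = m) (hπ : Continuous π)
    (hs : Function.Surjective π) (hT : ∀ σ τ, T (π (σ, τ)) = π (σ.shift, τ)) {r : ℝ}
    (hr : 0 < r) : ∃ C : ℕ, ∀ (K : Set Y) (n : ℕ), cov (dynDist (fun y z => dist y z) T n) K r ≤
      ((C * m ^ n : ℕ) : ℕ∞) := by
  obtain ⟨N, hN⟩ := exists_window hπ hr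
  refine ⟨Nat.card A * m ^ (2 * N) * (N + 2), fun K n => ?_⟩
  choose lift hlift using hs
  let L : ℕ → A → Type _ := fun k a => {L : List A // L.length = k ∧ (a :: L).IsChain R}
  have hL : ∀ k a, Finite (L k a) := fun k a => finite_chains a k
  let W := (Σ a, L (n + 2 * N) a) × Fin (N + 2)
  have hW : Nat.card W = Nat.card A * m ^ (2 * N) * (N + 2) * m ^ n := by
    have := Fintype.ofFinite A
    rw [Nat.card_prod, Nat.card_sigma, Finset.sum_congr rfl fun a _ => card_chains hR a _,
      Finset.sum_const, Finset.card_univ, ← Nat.card_eq_fintype_card, smul_eq_mul,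
      Nat.card_eq_fintype_card (α := Fin (N + 2)), Fintype.card_fin, pow_add]
    ring
  rw [← hW]
  let s : Subshift R → ℕ → A := fun σ j => σ.1 (-N + j)
  have hchain : ∀ σ j, R (s σ j) (s σ (j + 1)) := fun σ j => by
    have := σ.2 (-N + j)
    rw [add_assoc] at this
    exact_mod_cast this
  let f : K → W := fun y =>
    (⟨s (lift y).1 0, (List.range (n + 2 * N)).map fun j => s (lift y).1 (j + 1), by simp,
      isChain_cons_map_range (hchain _) _⟩, ⟨⌊((lift y).2 : ℝ) * (N + 1 : ℕ)⌋₊, by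
        rw [Nat.lt_succ_iff]
        exact Nat.floor_le_of_le (mul_le_of_le_one_left (Nat.cast_nonneg _) (lift y).2.2.2)⟩)
  refine cov_le_card f fun y y' h => ?_
  have h1 : s (lift y).1 0 = s (lift y').1 0 := congrArg (fun w : W => w.1.1) h
  have h2 : (List.range (n + 2 * N)).map (fun j => s (lift y).1 (j + 1)) =
      (List.range (n + 2 * N)).map fun j => s (lift y').1 (j + 1) :=
    congrArg (fun w : W => w.1.2.1) h
  have h3 := abs_sub_le_of_floor_eq (Nat.succ_pos N) (lift y).2.2.1 (lift y').2.2.1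
    (congrArg (fun w : W => (w.2 : ℕ)) h)
  have h4 : ∀ j ≤ n + 2 * N, s (lift y).1 j = s (lift y').1 j := by
    rintro (_ | j) hj
    · exact h1
    · exact List.map_inj_left.1 h2 j (List.mem_range.2 hj)
  refine Real.iSup_le (fun i => ?_) hr.le
  rw [← hlift y, ← hlift y']
  change dist (T^[i] (π ((lift y).1, (lift y).2))) (T^[i] (π ((lift y').1, (lift y').2))) ≤ r
  rw [iterate_coding hT, iterate_coding hT]
  refine hN _ _ (fun k hk => ?_) h3
  change (Subshift.shift^[i] (lift y).1).1 k = (Subshift.shift^[i] (lift y').1).1 k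
  rw [Subshift.shift_iterate, Subshift.shift_iterate]
  have hk' := abs_le.1 hk
  obtain ⟨j, hj⟩ := Int.eq_ofNat_of_zero_le (show 0 ≤ N + k + i by omega)
  have := h4 j (by have := i.2; omega)
  have e : k + (i : ℕ) = -N + (j : ℕ) := by omega
  rw [e]
  exact this

theorem entropyOn_le [MetricSpace Y] (hR : ∀ a, Nat.card {b // R a b} = m) (hπ : Continuous π)
    (hs : Function.Surjective π) (hT : ∀ σ τ, T (π (σ, τ)) = π (σ.shift, τ)) (K : Set Y) :
    entropyOn (fun y z => dist y z) T K ≤ ENNReal.log m := by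
  refine iSup₂_le fun r hr => ?_
  obtain ⟨C, hC⟩ := cov_dynDist_le hR hπ hs hT hr
  rw [← ExpGrowth.expGrowthSup_pow]
  refine ExpGrowth.expGrowthSup_le_of_eventually_le (b := C) (ENNReal.natCast_ne_top C)
    (Eventually.of_forall fun n => ?_)
  refine (ENat.toENNReal_le.2 (hC K n)).trans_eq ?_
  simp

/-- The lines at time `0` with different first letters are at distance bounded below, hence an
`r`-dense set for the dynamical distance separates the words of length `n`. -/
theorem le_cov_dynDist [MetricSpace Y] [Nonempty A] (hrefl : ∀ a, R a a)
    (hR : ∀ a, Nat.card {b // R a b} = m) (hπ : Continuous π)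
    (hT : ∀ σ τ, T (π (σ, τ)) = π (σ.shift, τ))
    (h0 : ∀ σ σ' : Subshift R, π (σ, 0) = π (σ', 0) → σ.1 0 = σ'.1 0) : ∃ r : ℝ, 0 < r ∧
      ∀ n, ((m ^ n : ℕ) : ℕ∞) ≤
        cov (dynDist (fun y z => dist y z) T n) (range fun σ : Subshift R => π (σ, 0)) r := by
  have : CompactSpace (Subshift R) := Subshift.compactSpace
  let P : Set (Subshift R × Subshift R) := {q | q.1.1 0 ≠ q.2.1 0}
  have hP : IsCompact P := by
    have hc : Continuous fun q : Subshift R × Subshift R => (q.1.1 0, q.2.1 0) :=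
      ((continuous_apply 0).comp (continuous_subtype_val.comp continuous_fst)).prodMk
        ((continuous_apply 0).comp (continuous_subtype_val.comp continuous_snd))
    exact ((isClosed_discrete {p : A × A | p.1 ≠ p.2}).preimage hc).isCompact
  obtain ⟨r, hr, hrP⟩ := hP.exists_forall_le' (f := fun q => dist (π (q.1, 0)) (π (q.2, 0)))
    (by fun_prop) (a := 0) fun q hq => dist_pos.2 fun h => hq (h0 _ _ h)
  refine ⟨r / 2, half_pos hr, fun n => le_iInf₂ fun S hS => ?_⟩
  have a₀ : A := Classical.arbitrary A
  let L := {L : List A // L.length = n ∧ (a₀ :: L).IsChain R}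
  have hx : ∀ w : L, ∃ σ : Subshift R, ∀ i, ∀ hi : i < w.1.length, σ.1 i = w.1[i] := by
    intro w
    obtain ⟨s, hs, -, hsw⟩ := exists_chain_extension hrefl w.1 a₀ w.2.2
    -- `s 0 = a₀` is repeated at negative times, and the letters of `w` start at time `0`.
    refine ⟨⟨fun k => s (k + 1).toNat, fun k => ?_⟩, fun i hi => ?_⟩
    swap
    · rw [← hsw i hi]
      change s (((i : ℤ) + 1).toNat) = _
      rw [show ((i : ℤ) + 1).toNat = i + 1 by omega]
    change R (s (k + 1).toNat) (s (k + 1 + 1).toNat)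
    rcases le_or_gt 0 (k + 1) with hk | hk
    · have : (k + 1 + 1).toNat = (k + 1).toNat + 1 := by omega
      rw [this]
      exact hs _
    · have : (k + 1 + 1).toNat = (k + 1).toNat := by omega
      rw [this]
      exact hrefl _
  choose σ hσ using hx
  choose z hzS hz using fun w => hS.2 _ (mem_range_self (σ w))
  choose σ' hσ' using fun x : S => hS.1 x.2
  have key : ∀ (w : L) (i : ℕ), i < n → (σ w).1 i = (σ' ⟨z w, hzS w⟩).1 i := by
    intro w i hi
    by_contra hne
    have h1 := (le_ciSup (f := fun i : Fin n => dist (T^[i] (π (σ w, 0))) (T^[i] (z w)))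
      (finite_range _).bddAbove ⟨i, hi⟩).trans (hz w)
    have h2 : z w = π (σ' ⟨z w, hzS w⟩, 0) := (hσ' ⟨z w, hzS w⟩).symm
    generalize σ' ⟨z w, hzS w⟩ = ρ at hne h2
    rw [h2] at h1
    simp only [iterate_coding hT] at h1
    have h3 := hrP (Subshift.shift^[i] (σ w), Subshift.shift^[i] ρ) (by
      change (Subshift.shift^[i] (σ w)).1 0 ≠ (Subshift.shift^[i] ρ).1 0
      rwa [Subshift.shift_iterate, Subshift.shift_iterate, zero_add])
    dsimp only at h3
    linarith
  have hinj : Function.Injective fun w : L => (⟨z w, hzS w⟩ : S) := by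
    intro w w' h
    dsimp only at h
    refine Subtype.ext (List.ext_getElem (w.2.1.trans w'.2.1.symm) fun i hi hi' => ?_)
    rw [← hσ w i hi, ← hσ w' i hi', key w i (w.2.1 ▸ hi), key w' i (w.2.1 ▸ hi), h]
  have : Finite L := finite_chains a₀ n
  rw [← card_chains hR a₀ n, ← ENat.card_eq_coe_natCard]
  exact ENat.card_le_card_of_injective hinj

theorem le_entropyOn [MetricSpace Y] [Nonempty A] (hrefl : ∀ a, R a a)
    (hR : ∀ a, Nat.card {b // R a b} = m) (hπ : Continuous π)
    (hT : ∀ σ τ, T (π (σ, τ)) = π (σ.shift, τ))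
    (h0 : ∀ σ σ' : Subshift R, π (σ, 0) = π (σ', 0) → σ.1 0 = σ'.1 0) :
    ENNReal.log m ≤
      entropyOn (fun y z => dist y z) T (range fun σ : Subshift R => π (σ, 0)) := by
  obtain ⟨r, hr, h⟩ := le_cov_dynDist hrefl hR hπ hT h0
  refine le_trans ?_ (le_iSup₂ (f := fun (r : ℝ) (_ : 0 < r) => limsup _ _) r hr)
  rw [← ExpGrowth.expGrowthSup_pow]
  refine ExpGrowth.expGrowthSup_monotone fun n => ?_
  refine le_trans ?_ (ENat.toENNReal_le.2 (h n))
  simp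

/-- The entropy of a system coded by a subshift on an alphabet in which every letter has `m`
successors. -/
theorem topEntropy_eq [TopologicalSpace Y] [TopologicalSpace.MetrizableSpace Y] [Nonempty A]
    (hrefl : ∀ a, R a a) (hR : ∀ a, Nat.card {b // R a b} = m) (hπ : Continuous π)
    (hs : Function.Surjective π) (hT : ∀ σ τ, T (π (σ, τ)) = π (σ.shift, τ))
    (h0 : ∀ σ σ' : Subshift R, π (σ, 0) = π (σ', 0) → σ.1 0 = σ'.1 0) :
    topEntropy T = ENNReal.log m := by
  apply le_antisymm
  · refine iInf₂_le_of_le (TopologicalSpace.metrizableSpaceMetric Y) rfl (iSup₂_le fun K _ => ?_)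
    let := TopologicalSpace.metrizableSpaceMetric Y
    exact entropyOn_le hR hπ hs hT K
  · refine le_iInf₂ fun d hd => ?_
    subst hd
    have : CompactSpace (Subshift R) := Subshift.compactSpace
    exact le_iSup₂_of_le _ (isCompact_range (by fun_prop)) (le_entropyOn hrefl hR hπ hT h0)

end Entropy

namespace DoubledTree

variable {ℓ : ℕ} [NeZero ℓ]

theorem metrizableSpace_geodQuot :
    TopologicalSpace.MetrizableSpace (GeodQuot (freeIsomGroup ℓ)) := by
  have : CompactSpace (Subshift (Letter.Follows (ℓ := ℓ))) := Subshift.compactSpace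
  have : CompactSpace (GeodQuot (freeIsomGroup ℓ)) := coding_surjective.compactSpace continuous_coding
  have := t2Space_geodQuot (isDiscreteGroup (ℓ := ℓ))
  have := secondCountableTopology_geodQuot (freeIsomGroup ℓ)
  infer_instance

theorem topEntropy_quotFlow : topEntropy (quotFlow (freeIsomGroup ℓ) 1) =
    ((Real.log (4 * (ℓ : ℝ) - 2) : ℝ) : EReal) := by
  have hℓ : 1 ≤ ℓ := NeZero.one_le
  have := metrizableSpace_geodQuot (ℓ := ℓ)
  rw [topEntropy_eq (R := Letter.Follows) (fun _ _ => rfl) Letter.card_follows continuous_coding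
    coding_surjective quotFlow_coding fun _ _ => apply_zero_eq_of_coding_eq]
  have h := ennreal_log_natCast (n := (2 * ℓ - 1) * 2) (by omega)
  rw [ENat.toENNReal_coe] at h
  rw [h, Nat.cast_mul, Nat.cast_sub (by omega)]
  push_cast
  congr 2
  ring

end DoubledTree

end GeodesicEntropy

end

theorem theorem1p2 (ℓ : ℕ) (hℓ : 1 ≤ ℓ) :
    -- the doubled tree
    (ProperSpace (DoubledTree ℓ) ∧ IsGeodesicSpace (DoubledTree ℓ) ∧
      IsGromovHyperbolic (DoubledTree ℓ) ∧ HasBoundedGeometry (DoubledTree ℓ) ∧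
      ¬ IsLineConvex (DoubledTree ℓ)) ∧
    -- the action of the free group
    (Function.Injective (action ℓ) ∧ IsDiscreteGroup (freeIsomGroup ℓ) ∧
      IsCocompactGroup (freeIsomGroup ℓ) ∧ IsFreeGroupAction (freeIsomGroup ℓ) ∧
      IsTorsionFreeGroup (freeIsomGroup ℓ) ∧ (2 ≤ ℓ → IsNonElementary (freeIsomGroup ℓ))) ∧
    -- the entropies
    topEntropy (quotFlow (freeIsomGroup ℓ) 1) = ((Real.log (4 * (ℓ : ℝ) - 2) : ℝ) : EReal) ∧
    ∀ x : DoubledTree ℓ,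
      critExponent (freeIsomGroup ℓ) x = ((Real.log (2 * (ℓ : ℝ) - 1) : ℝ) : EReal) ∧
      critExponent (freeIsomGroup ℓ) x < topEntropy (quotFlow (freeIsomGroup ℓ) 1) := by
  have : NeZero ℓ := ⟨by omega⟩
  refine ⟨⟨DoubledTree.properSpace, DoubledTree.isGeodesicSpace, DoubledTree.isGromovHyperbolic,
    DoubledTree.hasBoundedGeometry, DoubledTree.not_isLineConvex⟩,
    ⟨DoubledTree.action_injective, DoubledTree.isDiscreteGroup, DoubledTree.isCocompactGroup,
      DoubledTree.isFreeGroupAction, DoubledTree.isTorsionFreeGroup, DoubledTree.isNonElementary⟩,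
    DoubledTree.topEntropy_quotFlow, fun x => ⟨DoubledTree.critExponent_eq x, ?_⟩⟩
  rw [DoubledTree.critExponent_eq, DoubledTree.topEntropy_quotFlow, EReal.coe_lt_coe_iff]
  have hℓ' : (1 : ℝ) ≤ ℓ := by exact_mod_cast hℓ
  exact Real.log_lt_log (by linarith) (by linarith)
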